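/- Let $K$ be an oriented knot. For a diagram $D$ of $K$ (with at least one crossing), the Alexander matrix of $D$ is the matrix over $\mathbb{Z}[t,t^{-1}]$ of the homogeneous linear system expressing the colorings of the arcs of $D$ by the operation $x*y=tx+(1-t)y$ (one row per crossing, one column per arc, entries $t$, $1-t$, $-1$ in the columns of the arcs meeting at the crossing). The determinant of this matrix with one row and one column deleted is the Alexander polynomial of $K$, well defined up to a factor $\pm t^n$, $n\in\mathbb{Z}$; the reduced Alexander polynomial $$\Delta_K^0(t)=\sum_{i=0}^{k}c_it^i,\qquad c_k\neq 0,$$ is its representative in $\mathbb{Z}[t]$ with $c_0>0$. For a prime $p$ and an integer $m$, a $(p,m)$-coloring of a diagram is an assignment of elements of $\mathbb{Z}/p\mathbb{Z}$ to its arcs which satisfies the coloring condition at each crossing for the operation $x*y=mx+(1-m)y$: if the over-arc has color $y$ and the incoming and outgoing under-arcs have colors $x$ and $z$, then $z=x*y$ at a positive crossing and $x=z*y$ at a negative one. It is non-trivial if it is not constant. Let $\mathrm{mincol}_{p,m}(K)$ be the minimum, over all diagrams of $K$ and all their non-trivial $(p,m)$-colorings, of the number of colors used. Let $m$ be an integer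 such that $m>\max_{0\le i\le k}|c_i|+1$ and $p=\Delta_K^0(m)$ is an odd prime. Then non-trivial $(p,m)$-colorings of diagrams of $K$ exist in each of the following cases, and: 1. If $c_k=1$ and the penultimate non-zero coefficient of $\Delta_K^0$ (the coefficient of the second highest power of $t$ that occurs) is negative, then $k+1\le \mathrm{mincol}_{p,m}(K)$. 2. If $c_k>1$ or the penultimate non-zero coefficient of $\Delta_K^0$ is positive, then $k+2\le \mathrm{mincol}_{p,m}(K)$. -/

import Mathlib

/-!
Knots are treated combinatorially: a knot diagram is a signed Gauss word of genus zero (equivalently,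
an oriented one-component diagram on the sphere, up to isotopy), and a knot is a class of diagrams
modulo the Reidemeister moves.
-/

/-- One passage of the oriented curve through a crossing: the name of the crossing, whether the
curve runs over or under there, and the sign of the crossing (`pos = true` for a positive crossing,
at which the direction of the under-strand is obtained from that of the over-strand by a
counterclockwise turn by an angle less than `π`). -/
structure Passage where
  label : ℕ
  isOver : Bool
  pos : Bool
  deriving DecidableEq

/-- The other passage through the same crossing. -/
def Passage.partner (x : Passage) : Passage := ⟨x.label, !x.isOver, x.pos⟩

/-- A cyclic word, listed from some base point, is a signed Gauss word of a closed curve if every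
crossing that occurs in it is passed exactly once over and exactly once under, with one sign. -/
structure IsGaussWord (w : List Passage) : Prop where
  nodup : (w.map fun x => (x.label, x.isOver)).Nodup
  partner_mem : ∀ x ∈ w, x.partner ∈ w

/-- Walking along the boundary of a face that is kept on the left. The pair `(x, true)` stands for
leaving the crossing of `x` along the edge that follows `x`, traversed forward; `(x, false)` stands
for leaving it along the edge that precedes `x`, traversed backward. At the next crossing one turns
left into the other strand. -/
def faceStep {w : List Passage} (hw : IsGaussWord w) (d : {x // x ∈ w} × Bool) :
    {x // x ∈ w} × Bool :=
  let y : {x // x ∈ w} :=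
    if d.2 then ⟨w.next d.1.1 d.1.2, List.next_mem _ _ _⟩
    else ⟨w.prev d.1.1 d.1.2, List.prev_mem _ _ _⟩
  (⟨y.1.partner, hw.partner_mem _ y.2⟩, d.2 == (y.1.isOver == y.1.pos))

/-- The faces of the cellularly embedded four-valent graph described by a signed Gauss word. -/
def Face {w : List Passage} (hw : IsGaussWord w) : Type :=
  Quot fun d e : {x // x ∈ w} × Bool => e = faceStep hw d

/-- A signed Gauss word describes a diagram on the sphere if it has no crossing (a round circle) or
if its four-valent graph satisfies Euler's formula `V - E + F = 2`. -/
def IsPlanar {w : List Passage} (hw : IsGaussWord w) : Prop :=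
  w = [] ∨ ((w.map Passage.label).toFinset.card : ℤ) - w.length + Nat.card (Face hw) = 2

/-- An oriented knot diagram. -/
structure KnotDiagram where
  word : List Passage
  isGauss : IsGaussWord word
  planar : IsPlanar isGauss

/-- Two consecutive passages, in the given order or in the reversed one. -/
def passagePair (forward : Bool) (x y : Passage) : List Passage :=
  if forward then [x, y] else [y, x]

/-- The Reidemeister moves on signed Gauss words, together with the change of the base point and the
renaming of crossings. In a third Reidemeister move, the top strand passes over `a` and `b`, the
middle strand passes under `a` and over `c`, the bottom strand passes under `b` and `c`; the Booleans
`α`, `β`, `γ` record in which direction the three strands run along the triangle, and `δ` whether the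
vertices `a`, `b`, `c` of the triangle are met in the counterclockwise order. The signs of the three
crossings are forced by these data (`==` on Booleans is the product of signs); the move reverses
the order of the two passages on each strand. -/
inductive ReidemeisterMove : List Passage → List Passage → Prop
  | rotate (u v : List Passage) : ReidemeisterMove (u ++ v) (v ++ u)
  | relabel (σ : Equiv.Perm ℕ) (w : List Passage) :
      ReidemeisterMove w (w.map fun x => ⟨σ x.label, x.isOver, x.pos⟩)
  | r1 (c : ℕ) (o ε : Bool) (w : List Passage) :
      ReidemeisterMove ([⟨c, o, ε⟩, ⟨c, !o, ε⟩] ++ w) w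
  | r2 (c d : ℕ) (ε parallel : Bool) (u v : List Passage) :
      ReidemeisterMove
        ([⟨c, true, ε⟩, ⟨d, true, !ε⟩] ++ u ++
          passagePair parallel ⟨c, false, ε⟩ ⟨d, false, !ε⟩ ++ v)
        (u ++ v)
  | r3 (a b c : ℕ) (α β γ δ : Bool) (u v w : List Passage) :
      ReidemeisterMove
        (passagePair α ⟨a, true, δ == (α == β)⟩ ⟨b, true, δ == (α == γ)⟩ ++ u ++
          passagePair β ⟨a, false, δ == (α == β)⟩ ⟨c, true, δ == (β == γ)⟩ ++ v ++
          passagePair γ ⟨b, false, δ == (α == γ)⟩ ⟨c, false, δ == (β == γ)⟩ ++ w)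
        (passagePair (!α) ⟨a, true, δ == (α == β)⟩ ⟨b, true, δ == (α == γ)⟩ ++ u ++
          passagePair (!β) ⟨a, false, δ == (α == β)⟩ ⟨c, true, δ == (β == γ)⟩ ++ v ++
          passagePair (!γ) ⟨b, false, δ == (α == γ)⟩ ⟨c, false, δ == (β == γ)⟩ ++ w)
  | r3_bottom_second (a b c : ℕ) (α β γ δ : Bool) (u v w : List Passage) :
      ReidemeisterMove
        (passagePair α ⟨a, true, δ == (α == β)⟩ ⟨b, true, δ == (α == γ)⟩ ++ u ++
          passagePair γ ⟨b, false, δ == (α == γ)⟩ ⟨c, false, δ == (β == γ)⟩ ++ v ++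
          passagePair β ⟨a, false, δ == (α == β)⟩ ⟨c, true, δ == (β == γ)⟩ ++ w)
        (passagePair (!α) ⟨a, true, δ == (α == β)⟩ ⟨b, true, δ == (α == γ)⟩ ++ u ++
          passagePair (!γ) ⟨b, false, δ == (α == γ)⟩ ⟨c, false, δ == (β == γ)⟩ ++ v ++
          passagePair (!β) ⟨a, false, δ == (α == β)⟩ ⟨c, true, δ == (β == γ)⟩ ++ w)

/-- Oriented knots: knot diagrams modulo the equivalence relation generated by the Reidemeister
moves (all intermediate diagrams being diagrams on the sphere). -/
def Knot : Type := Quot fun D E : KnotDiagram => ReidemeisterMove D.word E.word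

/-- `D` is a diagram of the knot `K`. -/
def KnotDiagram.IsDiagramOf (D : KnotDiagram) (K : Knot) : Prop :=
  K = Quot.mk _ D

/-- The binary operation `x * y = m x + (1 - m) y` of an Alexander quandle. -/
def alexanderOp {R : Type*} [CommRing R] (m x y : R) : R := m * x + (1 - m) * y

namespace KnotDiagram

/-- The under-passages of a diagram, one for each crossing. -/
abbrev UnderPassage (D : KnotDiagram) : Type :=
  {x : Passage // x ∈ D.word.filter fun x => !x.isOver}

/-- A crossing, given by its under-passage. -/
abbrev Crossing (D : KnotDiagram) : Type := D.UnderPassage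

/-- The arcs of a diagram with at least one crossing: an arc runs from an under-passage to the next
under-passage, and is given by the under-passage at which it starts. (The round circle without
crossings has no crossing at which its only arc could start; as it has only constant colorings,
this arc never matters.) -/
abbrev Arc (D : KnotDiagram) : Type := D.UnderPassage

theorem filter_rotate_ne_nil (D : KnotDiagram) {x : Passage} (hx : x ∈ D.word) (n : ℕ) :
    (D.word.rotate n).filter (fun x => !x.isOver) ≠ [] := by
  have key : ∃ y ∈ D.word, y.isOver = false := by
    cases h : x.isOver with
    | false => exact ⟨x, hx, h⟩
    | true => exact ⟨x.partner, D.isGauss.partner_mem x hx, by simp [Passage.partner, h]⟩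
  obtain ⟨y, hy, hyo⟩ := key
  exact List.ne_nil_of_mem (List.mem_filter.2 ⟨List.mem_rotate.2 hy, by simp [hyo]⟩)

/-- The arc along which the curve arrives at the passage `x`: it starts at the last under-passage
that is met when the whole curve is travelled once, from `x` (included) until the return to `x`. -/
def arcAt (D : KnotDiagram) (x : Passage) (hx : x ∈ D.word) : D.Arc :=
  ⟨((D.word.rotate (D.word.idxOf x)).filter fun x => !x.isOver).getLast
      (D.filter_rotate_ne_nil hx _), by
    have h := List.getLast_mem (D.filter_rotate_ne_nil hx (D.word.idxOf x))
    rw [List.mem_filter, List.mem_rotate] at h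
    exact List.mem_filter.2 h⟩

/-- The arc that ends at a crossing. -/
def inArc (D : KnotDiagram) (c : D.Crossing) : D.Arc :=
  D.arcAt c.1 (List.mem_of_mem_filter c.2)

/-- The arc that starts at a crossing. -/
def outArc (D : KnotDiagram) (c : D.Crossing) : D.Arc := c

/-- The arc that runs over a crossing. -/
def overArc (D : KnotDiagram) (c : D.Crossing) : D.Arc :=
  D.arcAt c.1.partner (D.isGauss.partner_mem _ (List.mem_of_mem_filter c.2))

/-- Colorings of the arcs by the Alexander quandle with parameter `m`: with `x`, `z`, `y` the colors
of the incoming under-arc, of the outcoming under-arc and of the over-arc, one has `z = x * y` at a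
positive crossing, and `z = x *⁻¹ y`, that is, `x = z * y`, at a negative one. -/
def IsColoring (D : KnotDiagram) {R : Type*} [CommRing R] (m : R) (f : D.Arc → R) : Prop :=
  ∀ c : D.Crossing,
    if c.1.pos then f (D.outArc c) = alexanderOp m (f (D.inArc c)) (f (D.overArc c))
    else f (D.inArc c) = alexanderOp m (f (D.outArc c)) (f (D.overArc c))

open LaurentPolynomial in
/-- The Alexander matrix over `ℤ[t, t⁻¹]`, the matrix of the coloring conditions: the row of a
crossing has the entries `t`, `1 - t` and `-1` in the columns of the three arcs that meet there
(added up if some of these arcs coincide). -/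
noncomputable def alexanderMatrix (D : KnotDiagram) :
    Matrix D.Crossing D.Arc (LaurentPolynomial ℤ) := fun c a =>
  (if a = (if c.1.pos then D.inArc c else D.outArc c) then T 1 else 0) +
  (if a = D.overArc c then 1 - T 1 else 0) -
  (if a = (if c.1.pos then D.outArc c else D.inArc c) then 1 else 0)

end KnotDiagram

namespace Knot

open LaurentPolynomial in
/-- `P` is the reduced Alexander polynomial of `K`: it is a polynomial with positive constant term
that equals, up to a factor `± t ^ n` with `n ∈ ℤ`, the determinant of the Alexander matrix of a
diagram of `K` with one row and one column deleted. (The bijection `e` only serves to put the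
remaining columns into some order; it affects the sign of the determinant alone.) -/
def IsReducedAlexanderPolynomial (K : Knot) (P : Polynomial ℤ) : Prop :=
  0 < P.coeff 0 ∧
  ∃ D : KnotDiagram, D.IsDiagramOf K ∧
  ∃ (r : D.Crossing) (s : D.Arc) (e : {c : D.Crossing // c ≠ r} ≃ {a : D.Arc // a ≠ s}),
  ∃ (ε : ℤˣ) (n : ℤ),
    (D.alexanderMatrix.submatrix (fun i => i.1) (fun i => (e i).1)).det =
      C (ε : ℤ) * T n * Polynomial.toLaurent P

/-- The minimum number of colors of a non-trivial coloring of a diagram of `K` by the linear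
Alexander quandle `ℤ/n` with `x * y = m x + (1 - m) y`. (It is `0` if there is no such coloring.) -/
noncomputable def mincol (n : ℕ) (m : ℤ) (K : Knot) : ℕ :=
  sInf {q : ℕ | ∃ D : KnotDiagram, D.IsDiagramOf K ∧ ∃ f : D.Arc → ZMod n,
    D.IsColoring (m : ZMod n) f ∧ (∃ a b, f a ≠ f b) ∧ (Set.range f).ncard = q}

end Knot

/-! Take a non-trivial coloring modulo `p` with `n + 1` colors and identify arcs of equal color. The
coloring conditions become an integral linear system in `n + 1` unknowns, one per color. A rational
solution pulls back to a rational coloring with parameter `m`, which is constant because the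
Alexander polynomial takes the non-zero value `p` at `m`. So, after one unknown is set to zero, some
`n × n` minor is non-zero. The given coloring is a non-constant solution modulo `p`, so `p` divides
this minor and is at most its absolute value (`le_pow_of_solutions`).

A row of the system is `m e_x - (m - 1) e_y - e_z`, a sum of `m` differences of unit vectors.
Multilinearity splits the minor into `m ^ n` determinants of difference matrices, each in `{-1, 0,
1}`, whence `p ≤ m ^ n` (`abs_det_le_pow`). On the other hand, the size of `m` relative to the
coefficients gives `P(m) > m ^ (k - 1)`, and even `P(m) > m ^ k` in the second case. Comparing
exponents gives the bounds.

Two topological inputs are needed. The polynomial is computed from one diagram while the minimum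
runs over all of them, so having only constant colorings must be invariant under Reidemeister moves
(`KnotDiagram.onlyConst_iff`). Also `Knot.mincol` is `0` on an empty set, so non-trivial colorings
must be shown to exist. A vanishing minor only gives an assignment that may fail at one crossing;
planarity repairs this (`KnotDiagram.isColoring_of_ne`), since weights given by powers of `m`, read
off from a numbering of the regions, make the conditions linearly dependent. That numbering exists
by Euler's formula. -/

/-- `Walk m y w a b`: travelling along the word `w`, whose over-passage with label `l` has the
color `y l`, the color of the current edge changes from `a` to `b` according to the coloring
conditions of the Alexander quandle with parameter `m`. -/
def Walk {R : Type*} [Field R] (m : R) (y : ℕ → R) : List Passage → R → R → Prop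
  | [], a, b => b = a
  | x :: w, a, b =>
    if x.isOver then y x.label = a ∧ Walk m y w a b
    else Walk m y w (alexanderOp (if x.pos then m else m⁻¹) a (y x.label)) b

/-- The word `w` has only constant colorings. -/
def OnlyConst {R : Type*} [Field R] (m : R) (w : List Passage) : Prop :=
  ∀ (y : ℕ → R) (a : R), Walk m y w a a → ∀ x ∈ w, y x.label = a

/-! ### Colorings as closed walks along a word -/

section Walk

variable {R : Type*} [Field R] {m : R} {y y' : ℕ → R} {u v w : List Passage} {a b : R}

theorem alexanderOp_self (m a : R) : alexanderOp m a a = a := by unfold alexanderOp; ring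

theorem walk_append : Walk m y (u ++ v) a b ↔ ∃ c, Walk m y u a c ∧ Walk m y v c b := by
  induction u generalizing a with
  | nil => simp [Walk]
  | cons x u ih =>
    simp only [List.cons_append, Walk]
    split_ifs <;> simp [ih, and_assoc]

theorem walk_congr (h : ∀ x ∈ w, y x.label = y' x.label) :
    Walk m y w a b ↔ Walk m y' w a b := by
  induction w generalizing a with
  | nil => simp [Walk]
  | cons x u ih =>
    rw [List.forall_mem_cons] at h
    simp only [Walk, h.1, ih h.2]

theorem walk_update {c : ℕ} {z : R} (h : c ∉ w.map Passage.label) :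
    Walk m (Function.update y c z) w a b ↔ Walk m y w a b := by
  refine walk_congr fun x hx => Function.update_of_ne ?_ _ _
  rintro rfl
  exact h (List.mem_map_of_mem hx)

theorem Walk.eq_of_const (h : ∀ x ∈ w, y x.label = a) (hw : Walk m y w a b) : b = a := by
  induction w with
  | nil => exact hw
  | cons x u ih =>
    rw [List.forall_mem_cons] at h
    simp only [Walk, h.1, alexanderOp_self] at hw
    split_ifs at hw
    · exact ih h.2 hw.2
    · exact ih h.2 hw

theorem walk_relabel (σ : ℕ → ℕ) :
    Walk m y (w.map fun x => ⟨σ x.label, x.isOver, x.pos⟩) a b ↔ Walk m (y ∘ σ) w a b := by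
  induction w generalizing a with
  | nil => simp [Walk]
  | cons x u ih => simp only [List.map_cons, Walk, ih, Function.comp]

theorem onlyConst_rotate (h : OnlyConst m (u ++ v)) : OnlyConst m (v ++ u) := by
  intro y a hw x hx
  obtain ⟨b, hv, hu⟩ := walk_append.1 hw
  have key := h y b (walk_append.2 ⟨a, hu, hv⟩)
  have hab : a = b := hu.eq_of_const fun x hx => key x (by simp [hx])
  rw [hab]
  exact key x (by simpa [or_comm] using hx)

theorem onlyConst_relabel (σ : Equiv.Perm ℕ) :
    OnlyConst m (w.map fun x => ⟨σ x.label, x.isOver, x.pos⟩) ↔ OnlyConst m w := by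
  constructor
  · intro h y a hw x hx
    have := h (y ∘ σ.symm) a (by rw [walk_relabel]; simpa [Function.comp_def] using hw)
      _ (List.mem_map_of_mem hx)
    simpa using this
  · intro h y a hw x hx
    obtain ⟨z, hz, rfl⟩ := List.mem_map.1 hx
    exact h (y ∘ σ) a ((walk_relabel σ).1 hw) z hz

end Walk

/-- In a Gauss word both passages through a crossing may occur only once. -/
theorem IsGaussWord.label_notMem {w A B : List Passage} (hw : IsGaussWord w) (hp : w.Perm (A ++ B))
    {c : ℕ} (ht : (c, true) ∈ A.map fun x => (x.label, x.isOver))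
    (hf : (c, false) ∈ A.map fun x => (x.label, x.isOver)) : c ∉ B.map Passage.label := by
  have h := (hp.map fun x => (x.label, x.isOver)).nodup_iff.1 hw.nodup
  rw [List.map_append, List.nodup_append] at h
  intro hc
  obtain ⟨x, hx, rfl⟩ := List.mem_map.1 hc
  have hx' : (x.label, x.isOver) ∈ B.map fun x => (x.label, x.isOver) := List.mem_map_of_mem hx
  cases hb : x.isOver
  · rw [hb] at hx'
    exact h.2.2 _ hf _ hx' rfl
  · rw [hb] at hx'
    exact h.2.2 _ ht _ hx' rfl

/-! ### Invariance under Reidemeister moves -/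

section Moves

variable {R : Type*} [Field R] {m : R}

/-- At a kink the strand crosses itself, so either the over-color is the incoming color, or it is
the outgoing one and cancelling `m` or `m⁻¹` makes it the incoming one. The color passes unchanged.
-/
theorem onlyConst_r1 (hm : m ≠ 0) {c : ℕ} {o ε : Bool} {w : List Passage}
    (hw : IsGaussWord ([⟨c, o, ε⟩, ⟨c, !o, ε⟩] ++ w)) :
    OnlyConst m ([⟨c, o, ε⟩, ⟨c, !o, ε⟩] ++ w) ↔ OnlyConst m w := by
  have hc : c ∉ w.map Passage.label :=
    hw.label_notMem (List.Perm.refl _) (by cases o <;> simp) (by cases o <;> simp)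
  constructor
  · intro h y a hy x hx
    have := h (Function.update y c a) a
      (walk_append.2 ⟨a, by cases o <;> simp [Walk, alexanderOp_self], (walk_update hc).2 hy⟩)
      x (by simp [hx])
    rwa [Function.update_of_ne] at this
    rintro rfl
    exact hc (List.mem_map_of_mem hx)
  · intro h y a hy
    obtain ⟨b, h1, h2⟩ := walk_append.1 hy
    have hb : b = a ∧ y c = a := by
      cases o
      · simp only [Walk, Bool.not_false, if_true, if_false, Bool.false_eq_true] at h1
        obtain ⟨h1, rfl⟩ := h1
        rw [← h1, and_self]
        unfold alexanderOp at h1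
        have : (if ε = true then m else m⁻¹) ≠ 0 := by cases ε <;> simp [hm]
        refine mul_left_cancel₀ this ?_
        linear_combination h1
      · simp only [Walk, Bool.not_true, if_true, if_false, Bool.false_eq_true] at h1
        obtain ⟨h1, h2⟩ := h1
        rw [h1, alexanderOp_self] at h2
        exact ⟨h2, h1⟩
    obtain ⟨rfl, hb⟩ := hb
    intro x hx
    simp only [List.cons_append, List.nil_append, List.mem_cons] at hx
    rcases hx with rfl | rfl | hx
    · exact hb
    · exact hb
    · exact h y b h2 x hx

/-- The two crossings have the same over-color and opposite signs, so their actions on the lower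
strand are mutually inverse. -/
theorem onlyConst_r2 (hm : m ≠ 0) {c d : ℕ} {ε parallel : Bool} {u v : List Passage}
    (hw : IsGaussWord ([⟨c, true, ε⟩, ⟨d, true, !ε⟩] ++ u ++
          passagePair parallel ⟨c, false, ε⟩ ⟨d, false, !ε⟩ ++ v)) :
    OnlyConst m ([⟨c, true, ε⟩, ⟨d, true, !ε⟩] ++ u ++
          passagePair parallel ⟨c, false, ε⟩ ⟨d, false, !ε⟩ ++ v) ↔ OnlyConst m (u ++ v) := by
  have hp : List.Perm (α := Passage) ([⟨c, true, ε⟩, ⟨d, true, !ε⟩] ++ u ++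
          passagePair parallel ⟨c, false, ε⟩ ⟨d, false, !ε⟩ ++ v)
        (([⟨c, true, ε⟩, ⟨d, true, !ε⟩] ++ passagePair parallel ⟨c, false, ε⟩ ⟨d, false, !ε⟩) ++
          (u ++ v)) := by
    rw [List.perm_iff_count]; intro x; simp only [List.count_append]; omega
  have hc : c ∉ (u ++ v).map Passage.label :=
    hw.label_notMem hp (by simp) (by cases parallel <;> simp [passagePair])
  have hd : d ∉ (u ++ v).map Passage.label :=
    hw.label_notMem hp (by simp) (by cases parallel <;> simp [passagePair])
  have key : ∀ (y : ℕ → R) (z b b' : R), y c = z → y d = z →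
      (Walk m y (passagePair parallel ⟨c, false, ε⟩ ⟨d, false, !ε⟩) b b' ↔ b' = b) := by
    intro y z b b' h1 h2
    have : alexanderOp m (alexanderOp m⁻¹ b z) z = b := by unfold alexanderOp; field_simp; ring
    have : alexanderOp m⁻¹ (alexanderOp m b z) z = b := by unfold alexanderOp; field_simp; ring
    cases parallel <;> cases ε <;> simp [passagePair, Walk, *]
  constructor
  · intro h y a hy x hx
    obtain ⟨b, h1, h2⟩ := walk_append.1 hy
    rw [List.map_append, List.mem_append, not_or] at hc hd
    have hyd : (Function.update (Function.update y c a) d a) c = a := by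
      by_cases hcd : c = d
      · subst hcd; simp
      · simp [Function.update_of_ne hcd]
    have := h (Function.update (Function.update y c a) d a) a
      (walk_append.2 ⟨b, walk_append.2 ⟨b, walk_append.2 ⟨a, ?_, ?_⟩, ?_⟩, ?_⟩)
      x (by simp at hx ⊢; tauto)
    · rwa [Function.update_of_ne, Function.update_of_ne] at this
      · rintro rfl
        exact (not_or.2 hc) (by rw [← List.mem_append, ← List.map_append]
                                exact List.mem_map_of_mem hx)
      · rintro rfl
        exact (not_or.2 hd) (by rw [← List.mem_append, ← List.map_append]
                                exact List.mem_map_of_mem hx)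
    · simp [Walk, hyd]
    · rw [walk_update hd.1, walk_update hc.1]; exact h1
    · rw [key _ a b b hyd (by simp)]
    · rw [walk_update hd.2, walk_update hc.2]; exact h2
  · intro h y a hy
    obtain ⟨b, h5, h2⟩ := walk_append.1 hy
    obtain ⟨b', h6, h3⟩ := walk_append.1 h5
    obtain ⟨a', h7, h4⟩ := walk_append.1 h6
    simp only [Walk, if_true] at h7
    obtain ⟨h1, h1', rfl⟩ := h7
    rw [key _ a' b' b h1 h1'] at h3
    subst h3
    have := h y a' (walk_append.2 ⟨_, h4, h2⟩)
    intro x hx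
    simp only [List.mem_append, List.mem_cons, List.not_mem_nil, or_false] at hx
    rcases hx with (((rfl | rfl) | hx) | hx) | hx
    · exact h1
    · exact h1'
    · exact this x (by simp [hx])
    · cases parallel <;> simp only [passagePair, if_true, if_false, List.mem_cons, Bool.false_eq_true,
        List.not_mem_nil, or_false] at hx <;>
      rcases hx with rfl | rfl <;> assumption
    · exact this x (by simp [hx])

/-- The effect of a third Reidemeister move on the colors of the edges of the triangle: only the
color of the over-strand at the crossing `c` changes. -/
theorem walk_triangle (hm : m ≠ 0) {a b c : ℕ} (hac : a ≠ c) (hbc : b ≠ c) (α β γ δ : Bool)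
    (y : ℕ → R) {A A' B B' C C' : R}
    (h1 : Walk m y (passagePair α ⟨a, true, δ == (α == β)⟩ ⟨b, true, δ == (α == γ)⟩) A A')
    (h2 : Walk m y (passagePair β ⟨a, false, δ == (α == β)⟩ ⟨c, true, δ == (β == γ)⟩) B B')
    (h3 : Walk m y (passagePair γ ⟨b, false, δ == (α == γ)⟩ ⟨c, false, δ == (β == γ)⟩) C C') :
    ∃ z, (z = y a → y c = z) ∧
      Walk m (Function.update y c z)
        (passagePair (!α) ⟨a, true, δ == (α == β)⟩ ⟨b, true, δ == (α == γ)⟩) A A' ∧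
      Walk m (Function.update y c z)
        (passagePair (!β) ⟨a, false, δ == (α == β)⟩ ⟨c, true, δ == (β == γ)⟩) B B' ∧
      Walk m (Function.update y c z)
        (passagePair (!γ) ⟨b, false, δ == (α == γ)⟩ ⟨c, false, δ == (β == γ)⟩) C C' := by
  -- The move reverses the order of the middle strand's passages at `a` and `c`: over `c` it now
  -- carries its entering color if `c` came last before, and its leaving color otherwise.
  refine ⟨if β then B else B', ?_⟩
  cases α <;> cases β <;> cases γ <;> cases δ <;>
  simp [passagePair, Walk, hac, hbc, alexanderOp] at h1 h2 h3 ⊢ <;>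
  grind

/-- A third move changes only the color at `c`. Constancy of the new walk determines every other
color of the old one; the implication in `H` recovers the old color at `c`. -/
theorem onlyConst_of_walk_update {X Y : List Passage} {a c : ℕ} (hac : a ≠ c)
    (haY : a ∈ Y.map Passage.label) (hcY : c ∈ Y.map Passage.label)
    (hXY : ∀ x ∈ X, x.label ∈ Y.map Passage.label)
    (H : ∀ (y : ℕ → R) (p : R), Walk m y X p p →
      ∃ z, (z = y a → y c = z) ∧ Walk m (Function.update y c z) Y p p)
    (hY : OnlyConst m Y) : OnlyConst m X := by
  intro y p hy x hx
  obtain ⟨z, hz, hw⟩ := H y p hy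
  have key : ∀ l ∈ Y.map Passage.label, Function.update y c z l = p := by
    intro l hl
    obtain ⟨x, hx, rfl⟩ := List.mem_map.1 hl
    exact hY _ p hw x hx
  have h1 : y a = p := by rw [← key a haY, Function.update_of_ne hac]
  have h2 : z = p := by rw [← key c hcY, Function.update_self]
  by_cases hxc : x.label = c
  · rw [hxc, hz (h2.trans h1.symm), h2]
  · rw [← key _ (hXY x hx), Function.update_of_ne hxc]

/-- The crossings of the triangle of a third Reidemeister move are distinct, and do not occur in
the rest of the word. -/
theorem triangle_labels {a b c : ℕ} {α β γ s t r : Bool} {W v : List Passage}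
    (hW : IsGaussWord W)
    (hp : W.Perm ((passagePair α ⟨a, true, s⟩ ⟨b, true, t⟩ ++
      passagePair β ⟨a, false, s⟩ ⟨c, true, r⟩ ++ passagePair γ ⟨b, false, t⟩ ⟨c, false, r⟩) ++ v)) :
    a ≠ c ∧ b ≠ c ∧ c ∉ v.map Passage.label := by
  refine ⟨?_, ?_, hW.label_notMem hp ?_ ?_⟩
  · rintro rfl
    have := (hp.map fun x => (x.label, x.isOver)).nodup_iff.1 hW.nodup
    cases α <;> cases β <;> simp [passagePair] at this
  · rintro rfl
    have := (hp.map fun x => (x.label, x.isOver)).nodup_iff.1 hW.nodup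
    cases α <;> cases β <;> cases γ <;> simp [passagePair] at this
  · cases β <;> simp [passagePair]
  · cases γ <;> simp [passagePair]

theorem mem_passagePair {α : Bool} {x y z : Passage} :
    z ∈ passagePair α x y ↔ z = x ∨ z = y := by
  cases α <;> simp [passagePair, or_comm]

theorem onlyConst_of_r3 (hm : m ≠ 0) {a b c : ℕ} {α β γ δ : Bool} {u v w : List Passage}
    (hX : IsGaussWord
      (passagePair α ⟨a, true, δ == (α == β)⟩ ⟨b, true, δ == (α == γ)⟩ ++ u ++
        passagePair β ⟨a, false, δ == (α == β)⟩ ⟨c, true, δ == (β == γ)⟩ ++ v ++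
        passagePair γ ⟨b, false, δ == (α == γ)⟩ ⟨c, false, δ == (β == γ)⟩ ++ w))
    (h : OnlyConst m
      (passagePair (!α) ⟨a, true, δ == (α == β)⟩ ⟨b, true, δ == (α == γ)⟩ ++ u ++
        passagePair (!β) ⟨a, false, δ == (α == β)⟩ ⟨c, true, δ == (β == γ)⟩ ++ v ++
        passagePair (!γ) ⟨b, false, δ == (α == γ)⟩ ⟨c, false, δ == (β == γ)⟩ ++ w)) :
    OnlyConst m
      (passagePair α ⟨a, true, δ == (α == β)⟩ ⟨b, true, δ == (α == γ)⟩ ++ u ++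
        passagePair β ⟨a, false, δ == (α == β)⟩ ⟨c, true, δ == (β == γ)⟩ ++ v ++
        passagePair γ ⟨b, false, δ == (α == γ)⟩ ⟨c, false, δ == (β == γ)⟩ ++ w) := by
  obtain ⟨hac, hbc, hc⟩ := triangle_labels (a := a) (b := b) (c := c) (α := α) (β := β) (γ := γ)
    (s := δ == (α == β)) (t := δ == (α == γ)) (r := δ == (β == γ)) (v := u ++ v ++ w) hX (by
    rw [List.perm_iff_count]; intro x; simp only [List.count_append]; omega)
  simp only [List.map_append, List.mem_append, not_or] at hc
  refine onlyConst_of_walk_update hac ?_ ?_ ?_ (fun y p hy => ?_) h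
  · exact List.mem_map.2 ⟨⟨a, true, δ == (α == β)⟩, by simp [mem_passagePair], rfl⟩
  · exact List.mem_map.2 ⟨⟨c, true, δ == (β == γ)⟩, by simp [mem_passagePair], rfl⟩
  · intro x hx
    exact List.mem_map_of_mem (by simpa [mem_passagePair] using hx)
  · simp only [walk_append] at hy
    obtain ⟨C', ⟨C, ⟨B', ⟨B, ⟨A', h1, hu⟩, h2⟩, hv⟩, h3⟩, hw⟩ := hy
    obtain ⟨z, hz, k1, k2, k3⟩ := walk_triangle hm hac hbc α β γ δ y h1 h2 h3
    refine ⟨z, hz, ?_⟩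
    simp only [walk_append]
    exact ⟨C', ⟨C, ⟨B', ⟨B, ⟨A', k1, (walk_update hc.1.1).2 hu⟩, k2⟩,
      (walk_update hc.1.2).2 hv⟩, k3⟩, (walk_update hc.2).2 hw⟩

theorem onlyConst_of_r3_bottom_second (hm : m ≠ 0) {a b c : ℕ} {α β γ δ : Bool}
    {u v w : List Passage}
    (hX : IsGaussWord
      (passagePair α ⟨a, true, δ == (α == β)⟩ ⟨b, true, δ == (α == γ)⟩ ++ u ++
        passagePair γ ⟨b, false, δ == (α == γ)⟩ ⟨c, false, δ == (β == γ)⟩ ++ v ++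
        passagePair β ⟨a, false, δ == (α == β)⟩ ⟨c, true, δ == (β == γ)⟩ ++ w))
    (h : OnlyConst m
      (passagePair (!α) ⟨a, true, δ == (α == β)⟩ ⟨b, true, δ == (α == γ)⟩ ++ u ++
        passagePair (!γ) ⟨b, false, δ == (α == γ)⟩ ⟨c, false, δ == (β == γ)⟩ ++ v ++
        passagePair (!β) ⟨a, false, δ == (α == β)⟩ ⟨c, true, δ == (β == γ)⟩ ++ w)) :
    OnlyConst m
      (passagePair α ⟨a, true, δ == (α == β)⟩ ⟨b, true, δ == (α == γ)⟩ ++ u ++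
        passagePair γ ⟨b, false, δ == (α == γ)⟩ ⟨c, false, δ == (β == γ)⟩ ++ v ++
        passagePair β ⟨a, false, δ == (α == β)⟩ ⟨c, true, δ == (β == γ)⟩ ++ w) := by
  obtain ⟨hac, hbc, hc⟩ := triangle_labels (a := a) (b := b) (c := c) (α := α) (β := β) (γ := γ)
    (s := δ == (α == β)) (t := δ == (α == γ)) (r := δ == (β == γ)) (v := u ++ v ++ w) hX (by
    rw [List.perm_iff_count]; intro x; simp only [List.count_append]; omega)
  simp only [List.map_append, List.mem_append, not_or] at hc
  refine onlyConst_of_walk_update hac ?_ ?_ ?_ (fun y p hy => ?_) h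
  · exact List.mem_map.2 ⟨⟨a, true, δ == (α == β)⟩, by simp [mem_passagePair], rfl⟩
  · exact List.mem_map.2 ⟨⟨c, true, δ == (β == γ)⟩, by simp [mem_passagePair], rfl⟩
  · intro x hx
    exact List.mem_map_of_mem (by simpa [mem_passagePair] using hx)
  · simp only [walk_append] at hy
    obtain ⟨C', ⟨C, ⟨B', ⟨B, ⟨A', h1, hu⟩, h2⟩, hv⟩, h3⟩, hw⟩ := hy
    obtain ⟨z, hz, k1, k2, k3⟩ := walk_triangle hm hac hbc α β γ δ y h1 h3 h2
    refine ⟨z, hz, ?_⟩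
    simp only [walk_append]
    exact ⟨C', ⟨C, ⟨B', ⟨B, ⟨A', k1, (walk_update hc.1.1).2 hu⟩, k3⟩,
      (walk_update hc.1.2).2 hv⟩, k2⟩, (walk_update hc.2).2 hw⟩

theorem ReidemeisterMove.onlyConst_iff (hm : m ≠ 0) {X Y : List Passage}
    (h : ReidemeisterMove X Y) (hX : IsGaussWord X) (hY : IsGaussWord Y) :
    OnlyConst m X ↔ OnlyConst m Y := by
  have flip : ∀ x y : Bool, ((!x) == (!y)) = (x == y) := by decide
  cases h with
  | rotate u v => exact ⟨onlyConst_rotate, onlyConst_rotate⟩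
  | relabel σ w => exact (onlyConst_relabel σ).symm
  | r1 c o ε w => exact onlyConst_r1 hm hX
  | r2 c d ε parallel u v => exact onlyConst_r2 hm hX
  | r3 a b c α β γ δ u v w =>
    refine ⟨fun h => ?_, onlyConst_of_r3 hm hX⟩
    -- The inverse move is the same move with all three strand directions negated; the signs depend
    -- only on products of two directions and are unaffected.
    have := onlyConst_of_r3 (α := !α) (β := !β) (γ := !γ) (δ := δ) (a := a) (b := b) (c := c)
      (u := u) (v := v) (w := w) hm
    simp only [flip, Bool.not_not] at this
    exact this hY h
  | r3_bottom_second a b c α β γ δ u v w =>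
    refine ⟨fun h => ?_, onlyConst_of_r3_bottom_second hm hX⟩
    have := onlyConst_of_r3_bottom_second (α := !α) (β := !β) (γ := !γ) (δ := δ) (a := a) (b := b)
      (c := c) (u := u) (v := v) (w := w) hm
    simp only [flip, Bool.not_not] at this
    exact this hY h

/-- Two diagrams of the same knot both have a non-constant coloring, or both have none. -/
theorem KnotDiagram.onlyConst_iff (hm : m ≠ 0) {D E : KnotDiagram} {K : Knot}
    (hD : D.IsDiagramOf K) (hE : E.IsDiagramOf K) : OnlyConst m D.word ↔ OnlyConst m E.word := by
  have h : Quot.mk (fun D E : KnotDiagram => ReidemeisterMove D.word E.word) D = Quot.mk _ E :=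
    hD.symm.trans hE
  have := congrArg (Quot.lift (fun D : KnotDiagram => OnlyConst m D.word)
    fun D E h => propext (h.onlyConst_iff hm D.isGauss E.isGauss)) h
  exact iff_of_eq this

end Moves

/-! ### The cyclic structure of a Gauss word -/

section Passages

variable {w : List Passage}

theorem IsGaussWord.nodup_word (hw : IsGaussWord w) : w.Nodup := List.Nodup.of_map _ hw.nodup

/-- The successor of a passage in the cyclic word. -/
def IsGaussWord.next (hw : IsGaussWord w) : Equiv.Perm {x // x ∈ w} where
  toFun x := ⟨w.next x.1 x.2, List.next_mem _ _ _⟩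
  invFun x := ⟨w.prev x.1 x.2, List.prev_mem _ _ _⟩
  left_inv x := Subtype.ext (List.prev_next _ hw.nodup_word _ x.2)
  right_inv x := Subtype.ext (List.next_prev _ hw.nodup_word _ x.2)

/-- The involution that exchanges the two passages through each crossing. -/
def IsGaussWord.partner (hw : IsGaussWord w) : Equiv.Perm {x // x ∈ w} where
  toFun x := ⟨x.1.partner, hw.partner_mem _ x.2⟩
  invFun x := ⟨x.1.partner, hw.partner_mem _ x.2⟩
  left_inv x := by simp [Passage.partner]
  right_inv x := by simp [Passage.partner]

theorem IsGaussWord.partner_partner (hw : IsGaussWord w) (x : {x // x ∈ w}) :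
    hw.partner (hw.partner x) = x := hw.partner.left_inv x

theorem IsGaussWord.next_getElem (hw : IsGaussWord w) (i : ℕ) (hi : i < w.length) :
    hw.next ⟨w[i], List.getElem_mem hi⟩ =
      ⟨w[(i + 1) % w.length]'(Nat.mod_lt _ (by omega)), List.getElem_mem _⟩ :=
  Subtype.ext (List.next_getElem _ hw.nodup_word _ _)

/-- A property of passages that is inherited by the successor holds for all passages as soon as it
holds for one. -/
theorem IsGaussWord.next_induction (hw : IsGaussWord w) {S : {x // x ∈ w} → Prop}
    (h : ∀ x, S x → S (hw.next x)) {a : {x // x ∈ w}} (ha : S a) (x : {x // x ∈ w}) : S x := by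
  obtain ⟨a, haw⟩ := a
  obtain ⟨i, hi, rfl⟩ := List.getElem_of_mem haw
  have hpos : 0 < w.length := by omega
  have key : ∀ n : ℕ, S ⟨w[(i + n) % w.length]'(Nat.mod_lt _ hpos), List.getElem_mem _⟩ := by
    intro n
    induction n with
    | zero => simpa [Nat.mod_eq_of_lt hi] using ha
    | succ n ih =>
      have := h _ ih
      rw [hw.next_getElem] at this
      simpa [add_assoc] using this
  obtain ⟨x, hx⟩ := x
  obtain ⟨j, hj, rfl⟩ := List.getElem_of_mem hx
  have h2 := key (j + (w.length - i))
  have h3 : (i + (j + (w.length - i))) % w.length = j := by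
    rw [show i + (j + (w.length - i)) = j + w.length by omega, Nat.add_mod_right,
      Nat.mod_eq_of_lt hj]
  simpa only [h3] using h2

theorem IsGaussWord.eq_of_key_eq (hw : IsGaussWord w) {x y : Passage} (hx : x ∈ w) (hy : y ∈ w)
    (h1 : x.label = y.label) (h2 : x.isOver = y.isOver) : x = y :=
  List.inj_on_of_nodup_map hw.nodup hx hy (by rw [h1, h2])

end Passages

/-! ### Colors of arcs and of edges -/

namespace KnotDiagram

variable (D : KnotDiagram)

/-- The arc that ends at an under-passage is followed by the arc that starts there; at an
over-passage the arc continues. -/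
theorem arcAt_next (x : {x // x ∈ D.word}) :
    D.arcAt (D.isGauss.next x).1 (D.isGauss.next x).2 =
      if h : x.1.isOver = true then D.arcAt x.1 x.2
      else ⟨x.1, List.mem_filter.2 ⟨x.2, by simpa using h⟩⟩ := by
  have hnd := D.isGauss.nodup_word
  obtain ⟨x, hx⟩ := x
  obtain ⟨i, hi, rfl⟩ := List.getElem_of_mem hx
  have h1 : D.word.rotate i = D.word[i] :: (D.word.rotate i).tail := by
    have hne : D.word.rotate i ≠ [] := by
      rw [Ne, List.rotate_eq_nil_iff]; exact List.ne_nil_of_mem hx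
    conv_lhs => rw [← List.cons_head_tail hne]
    rw [List.head_eq_getElem, List.getElem_rotate]
    simp [Nat.mod_eq_of_lt hi]
  have h2 : D.word.rotate ((i + 1) % D.word.length) = (D.word.rotate i).tail ++ [D.word[i]] := by
    rw [List.rotate_mod, ← List.rotate_rotate]
    conv_lhs => rw [h1]
    simp
  have key : (D.arcAt (D.isGauss.next ⟨D.word[i], hx⟩).1 (D.isGauss.next ⟨D.word[i], hx⟩).2).1 =
      (if h : D.word[i].isOver = true then D.arcAt D.word[i] hx
      else ⟨D.word[i], List.mem_filter.2 ⟨hx, by simpa using h⟩⟩ : D.Arc).1 := by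
    simp only [D.isGauss.next_getElem i hi]
    unfold arcAt
    simp only [hnd.idxOf_getElem, h2]
    split_ifs with h
    · simp only [List.filter_append, List.filter_cons, h, Bool.not_true, Bool.false_eq_true,
        if_false, List.filter_nil, List.append_nil]
      congr 1
      rw [h1]
      simp [h]
    · simp [List.filter_append, h]
  exact Subtype.ext key

/-- The color of the edge that arrives at a passage. -/
def edgeColor {R : Type*} (f : D.Arc → R) (x : {x // x ∈ D.word}) : R := f (D.arcAt x.1 x.2)


section Coloring

variable {D} {R : Type*}

theorem edgeColor_next_of_isOver (f : D.Arc → R) {x : {x // x ∈ D.word}} (hx : x.1.isOver = true) :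
    D.edgeColor f (D.isGauss.next x) = D.edgeColor f x := by
  unfold edgeColor
  rw [D.arcAt_next, dif_pos hx]

theorem edgeColor_next (f : D.Arc → R) (c : D.Crossing) :
    D.edgeColor f (D.isGauss.next ⟨c.1, List.mem_of_mem_filter c.2⟩) = f c := by
  have hc : ¬ (c.1.isOver = true) := by simpa using (List.mem_filter.1 c.2).2
  unfold edgeColor
  rw [D.arcAt_next, dif_neg hc]

/-- Every function on the edges that is constant along the arcs comes from a function on the
arcs. -/
theorem edgeColor_of_edges [Nonempty D.Arc] {q : {x // x ∈ D.word} → R}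
    (hq : ∀ x, x.1.isOver = true → q (D.isGauss.next x) = q x) :
    D.edgeColor (fun c : D.Arc => q (D.isGauss.next ⟨c.1, List.mem_of_mem_filter c.2⟩)) = q := by
  obtain ⟨c⟩ := ‹Nonempty D.Arc›
  set f : D.Arc → R := fun c => q (D.isGauss.next ⟨c.1, List.mem_of_mem_filter c.2⟩)
  funext x
  refine D.isGauss.next_induction (S := fun x => D.edgeColor f x = q x) (fun x hx => ?_)
    (edgeColor_next f c) x
  by_cases h : x.1.isOver = true
  · rw [edgeColor_next_of_isOver f h, hq x h]
    exact hx
  · exact edgeColor_next f ⟨x.1, List.mem_filter.2 ⟨x.2, by simpa using h⟩⟩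

end Coloring

end KnotDiagram

/-! ### Closed walks as edge colorings -/

section WalkSequence

variable {R : Type*} [Field R] {m : R} {y : ℕ → R}

/-- The coloring condition at a single passage. -/
def PassageStep (m : R) (y : ℕ → R) (x : Passage) (a b : R) : Prop :=
  if x.isOver then y x.label = a ∧ b = a
  else b = alexanderOp (if x.pos then m else m⁻¹) a (y x.label)

theorem walk_cons {x : Passage} {w : List Passage} {a b : R} :
    Walk m y (x :: w) a b ↔ ∃ c, PassageStep m y x a c ∧ Walk m y w c b := by
  unfold PassageStep
  simp only [Walk]
  split_ifs <;> simp

theorem walk_iff_exists_seq {w : List Passage} {a b : R} :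
    Walk m y w a b ↔ ∃ Q : ℕ → R, Q 0 = a ∧ Q w.length = b ∧
      ∀ (i : ℕ) (hi : i < w.length), PassageStep m y w[i] (Q i) (Q (i + 1)) := by
  induction w generalizing a with
  | nil =>
    constructor
    · rintro rfl
      exact ⟨fun _ => b, rfl, rfl, fun i hi => by simp at hi⟩
    · rintro ⟨Q, h1, h2, -⟩
      exact h2.symm.trans h1
  | cons x w ih =>
    rw [walk_cons]
    constructor
    · rintro ⟨c, hx, hw⟩
      obtain ⟨Q, h0, h1, h2⟩ := ih.1 hw
      refine ⟨fun i => Nat.casesOn i a Q, rfl, h1, fun i hi => ?_⟩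
      cases i with
      | zero => simpa [h0] using hx
      | succ i => exact h2 i (by simpa using hi)
    · rintro ⟨Q, h0, h1, h2⟩
      refine ⟨Q 1, ?_, ih.2 ⟨fun i => Q (i + 1), rfl, h1, fun i hi => ?_⟩⟩
      · have := h2 0 (by simp)
        simpa [h0] using this
      · exact h2 (i + 1) (by simpa using hi)

theorem eq_alexanderOp_inv_iff (hm : m ≠ 0) {a b y : R} :
    b = alexanderOp m⁻¹ a y ↔ a = alexanderOp m b y := by
  unfold alexanderOp
  constructor <;> rintro rfl <;> field_simp <;> ring

/-- Closed walks are edge colorings. -/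
theorem IsGaussWord.exists_edges_of_walk {w : List Passage} (hw : IsGaussWord w) {a : R}
    (h : Walk m y w a a) :
    ∃ q : {x // x ∈ w} → R, (∀ x, PassageStep m y x.1 (q x) (q (hw.next x))) ∧
      ∀ hpos : 0 < w.length, q ⟨w[0], List.getElem_mem _⟩ = a := by
  obtain ⟨Q, h0, h1, h2⟩ := walk_iff_exists_seq.1 h
  refine ⟨fun x => Q (w.idxOf x.1), fun x => ?_,
    fun hpos => by simp only [hw.nodup_word.idxOf_getElem, h0]⟩
  obtain ⟨x, hx⟩ := x
  obtain ⟨i, hi, rfl⟩ := List.getElem_of_mem hx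
  rw [hw.next_getElem i hi]
  simp only [hw.nodup_word.idxOf_getElem]
  convert! h2 i hi using 1
  by_cases hi' : i + 1 < w.length
  · rw [Nat.mod_eq_of_lt hi']
  · rw [show i + 1 = w.length by omega, Nat.mod_self, h0, h1]

theorem IsGaussWord.walk_of_edges {w : List Passage} (hw : IsGaussWord w)
    {q : {x // x ∈ w} → R} (hq : ∀ x, PassageStep m y x.1 (q x) (q (hw.next x)))
    (hpos : 0 < w.length) : ∃ a, Walk m y w a a := by
  refine ⟨q ⟨w[0], List.getElem_mem _⟩, walk_iff_exists_seq.2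
    ⟨fun i => q ⟨w[i % w.length]'(Nat.mod_lt _ hpos), List.getElem_mem _⟩, ?_, ?_, ?_⟩⟩
  · simp
  · simp
  · intro i hi
    have := hq ⟨w[i], List.getElem_mem _⟩
    rw [hw.next_getElem] at this
    simpa only [Nat.mod_eq_of_lt hi] using this

end WalkSequence

/-! ### Translation between arc colorings and walks -/

namespace KnotDiagram

variable {D : KnotDiagram} {R : Type*} [Field R] {m : R}

/-- The passage from below at a crossing. -/
def under (c : D.Crossing) : {x // x ∈ D.word} := ⟨c.1, List.mem_of_mem_filter c.2⟩

theorem under_isOver (c : D.Crossing) : (under c).1.isOver = false := by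
  have : c.1.isOver = false := by simpa using (List.mem_filter.1 c.2).2
  exact this

theorem exists_under_eq {x : {x // x ∈ D.word}} (hx : x.1.isOver = false) :
    ∃ c : D.Crossing, under c = x :=
  ⟨⟨x.1, List.mem_filter.2 ⟨x.2, by simpa using hx⟩⟩, rfl⟩

theorem nonempty_arc {x : Passage} (hx : x ∈ D.word) : Nonempty D.Arc := ⟨D.arcAt x hx⟩

section Edges

omit [Field R]

theorem inArc_eq (f : D.Arc → R) (c : D.Crossing) : f (D.inArc c) = D.edgeColor f (under c) := rfl

theorem outArc_eq (f : D.Arc → R) (c : D.Crossing) :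
    f (D.outArc c) = D.edgeColor f (D.isGauss.next (under c)) := (edgeColor_next f c).symm

theorem overArc_eq (f : D.Arc → R) (c : D.Crossing) :
    f (D.overArc c) = D.edgeColor f (D.isGauss.partner (under c)) := rfl

theorem eq_const_of_edgeColor {f : D.Arc → R} {k : R} (h : ∀ x, D.edgeColor f x = k) (a : D.Arc) :
    f a = k := by rw [← edgeColor_next f a]; exact h _

end Edges

/-- Both signs are treated uniformly: a negative crossing acts with parameter `m⁻¹` in the direction
of travel. -/
theorem isColoring_iff (hm : m ≠ 0) {f : D.Arc → R} : D.IsColoring m f ↔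
    ∀ c : D.Crossing, D.edgeColor f (D.isGauss.next (under c)) =
      alexanderOp (if c.1.pos then m else m⁻¹) (D.edgeColor f (under c))
        (D.edgeColor f (D.isGauss.partner (under c))) := by
  refine forall_congr' fun c => ?_
  rw [inArc_eq f c, outArc_eq f c, overArc_eq f c]
  split_ifs
  · rfl
  · rw [eq_alexanderOp_inv_iff hm]

theorem onlyConst_of_forall (hm : m ≠ 0)
    (h : ∀ f : D.Arc → R, D.IsColoring m f → ∀ a b, f a = f b) : OnlyConst m D.word := by
  intro y a hw x hx
  have hne := nonempty_arc hx
  obtain ⟨q, hq, hqa⟩ := D.isGauss.exists_edges_of_walk hw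
  set f : D.Arc → R := fun c => q (D.isGauss.next ⟨c.1, List.mem_of_mem_filter c.2⟩)
  have hf : D.edgeColor f = q := edgeColor_of_edges fun x hx => by
    have := hq x
    rw [PassageStep, if_pos hx] at this
    exact this.2
  have hover : ∀ x : {x // x ∈ D.word}, x.1.isOver = true → y x.1.label = q x := by
    intro x hx
    have := hq x
    rw [PassageStep, if_pos hx] at this
    exact this.1
  have hpart : ∀ x : {x // x ∈ D.word}, x.1.isOver = false →
      y x.1.label = q (D.isGauss.partner x) := fun x hx =>
    hover (D.isGauss.partner x) (by simp [IsGaussWord.partner, Passage.partner, hx])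
  have hcol : D.IsColoring m f := by
    rw [isColoring_iff hm, hf]
    intro c
    have := hq (under c)
    rw [PassageStep, under_isOver, if_neg Bool.false_ne_true, hpart _ (under_isOver c)] at this
    exact this
  obtain ⟨c⟩ := hne
  have hconst : ∀ z, q z = f c := by
    intro z
    rw [← hf]
    exact h f hcol _ _
  have ha : f c = a := by rw [← hconst, hqa (List.length_pos_of_mem hx)]
  rw [← ha]
  cases hxo : x.isOver
  · exact (hpart ⟨x, hx⟩ hxo).trans (hconst _)
  · exact (hover ⟨x, hx⟩ hxo).trans (hconst _)

theorem eq_of_onlyConst (hm : m ≠ 0) (h : OnlyConst m D.word) {f : D.Arc → R}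
    (hf : D.IsColoring m f) (a b : D.Arc) : f a = f b := by
  classical
  set q := D.edgeColor f
  -- The default `0` is harmless: every label occurring in the word has an over-passage, unique by
  -- the Gauss condition.
  set y : ℕ → R := fun l =>
    if h : ∃ x : {x // x ∈ D.word}, x.1.label = l ∧ x.1.isOver = true then q h.choose else 0
  have hover : ∀ x : {x // x ∈ D.word}, x.1.isOver = true → y x.1.label = q x := by
    intro x hx
    have hex : ∃ z : {x // x ∈ D.word}, z.1.label = x.1.label ∧ z.1.isOver = true := ⟨x, rfl, hx⟩
    simp only [y, dif_pos hex]
    congr 1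
    exact Subtype.ext (D.isGauss.eq_of_key_eq hex.choose.2 x.2 hex.choose_spec.1
      (hex.choose_spec.2.trans hx.symm))
  have hpart : ∀ x : {x // x ∈ D.word}, x.1.isOver = false →
      y x.1.label = q (D.isGauss.partner x) := fun x hx =>
    hover (D.isGauss.partner x) (by simp [IsGaussWord.partner, Passage.partner, hx])
  have hstep : ∀ x, PassageStep m y x.1 (q x) (q (D.isGauss.next x)) := by
    intro x
    cases hx : x.1.isOver
    swap
    · rw [PassageStep, if_pos hx]
      exact ⟨hover x hx, edgeColor_next_of_isOver f hx⟩
    · rw [PassageStep, hx, if_neg Bool.false_ne_true]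
      obtain ⟨c, rfl⟩ := exists_under_eq hx
      rw [hpart _ (under_isOver c)]
      exact (isColoring_iff hm).1 hf c
  obtain ⟨k, hk⟩ := D.isGauss.walk_of_edges hstep
    (List.length_pos_of_mem (List.mem_of_mem_filter a.2))
  have hy := h y k hk
  have hov : ∀ x : {x // x ∈ D.word}, x.1.isOver = true → q x = k := fun x hx =>
    (hover x hx).symm.trans (hy x.1 x.2)
  have hq : ∀ x, q x = k := by
    refine D.isGauss.next_induction (a := D.isGauss.partner (under a)) (fun x hx => ?_)
      (hov _ (by simp [IsGaussWord.partner, Passage.partner, under_isOver]))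
    have := hstep x
    rw [PassageStep, hy x.1 x.2, hx, alexanderOp_self] at this
    split_ifs at this
    · exact this.2
    · exact this
  rw [eq_const_of_edgeColor hq a, eq_const_of_edgeColor hq b]

end KnotDiagram

/-! ### Rank bounds and orthogonal complements over the rationals -/

section LinearAlgebra

theorem card_le_finrank_range_add_one {α M : Type*} [Fintype α] [AddCommGroup M] [Module ℚ M]
    (T : (α → ℚ) →ₗ[ℚ] M) (hT : ∀ f, T f = 0 → ∃ k, ∀ a, f a = k) :
    Fintype.card α ≤ Module.finrank ℚ T.range + 1 := by
  have h1 := T.finrank_range_add_finrank_ker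
  rw [Module.finrank_fintype_fun_eq_card] at h1
  have h2 : T.ker ≤ Submodule.span ℚ {fun _ => 1} := by
    intro f hf
    obtain ⟨k, hk⟩ := hT f hf
    exact Submodule.mem_span_singleton.2 ⟨k, funext fun a => by simp [hk]⟩
  have h3 := (Submodule.finrank_mono h2).trans (finrank_span_le_card _)
  rw [Set.toFinset_singleton, Finset.card_singleton] at h3
  omega

/-- An orthogonal pair of subspaces of `α → ℚ` of full total dimension: every vector orthogonal to
the first one is in the second one. -/
theorem mem_of_orthogonal {α : Type*} [Fintype α] {U V : Submodule ℚ (α → ℚ)}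
    (h : ∀ u ∈ U, ∀ v ∈ V, ∑ a, u a * v a = 0)
    (hcard : Fintype.card α ≤ Module.finrank ℚ U + Module.finrank ℚ V)
    {z : α → ℚ} (hz : ∀ u ∈ U, ∑ a, u a * z a = 0) : z ∈ V := by
  set W := V ⊔ Submodule.span ℚ {z}
  have hW : ∀ u ∈ U, ∀ v ∈ W, ∑ a, u a * v a = 0 := by
    intro u hu v hv
    obtain ⟨v, hv', t, ht, rfl⟩ := Submodule.mem_sup.1 hv
    obtain ⟨c, rfl⟩ := Submodule.mem_span_singleton.1 ht
    have h2 : ∑ a, u a * (c * z a) = c * ∑ a, u a * z a := by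
      rw [Finset.mul_sum]; exact Finset.sum_congr rfl fun a _ => by ring
    simp only [Pi.add_apply, Pi.smul_apply, smul_eq_mul, mul_add, Finset.sum_add_distrib,
      h u hu v hv', h2, hz u hu, mul_zero, add_zero]
  -- A common vector is orthogonal to itself, hence zero, because a sum of rational squares vanishes
  -- only termwise.
  have hdis : Disjoint U W := by
    rw [Submodule.disjoint_def]
    intro x hx hx'
    have := (Finset.sum_eq_zero_iff_of_nonneg fun a _ => mul_self_nonneg (x a)).1 (hW x hx x hx')
    exact funext fun a => mul_self_eq_zero.1 (this a (Finset.mem_univ a))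
  have h1 := Submodule.finrank_add_finrank_le_of_disjoint hdis
  rw [Module.finrank_fintype_fun_eq_card] at h1
  have h2 : V = W := Submodule.eq_of_le_of_finrank_le le_sup_left (by omega)
  rw [h2]
  exact Submodule.mem_sup_right (Submodule.mem_span_singleton_self z)

end LinearAlgebra

/-! ### Euler's formula and the numbering of regions -/

section Faces

variable {w : List Passage}

/-- Whether a left turn at the passage `x` leads into the forward direction of the other strand. -/
def Passage.turn (x : Passage) : Bool := x.isOver == x.pos

theorem Passage.turn_partner (x : Passage) : x.partner.turn = !x.turn := by
  rcases x with ⟨l, o, p⟩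
  cases o <;> cases p <;> rfl

/-- The face on the left of a direction along an edge. -/
def IsGaussWord.face (hw : IsGaussWord w) (x : {x // x ∈ w}) (d : Bool) : Face hw :=
  Quot.mk _ (x, d)

/-- This and the next identity are single steps of the boundary walk, indexed by the crossing that
is reached. -/
theorem IsGaussWord.face_true (hw : IsGaussWord w) (x : {x // x ∈ w}) :
    hw.face (hw.next.symm x) true = hw.face (hw.partner x) x.1.turn := by
  refine Quot.sound ?_
  have : ∀ y : {x // x ∈ w}, faceStep hw (y, true) =
      (hw.partner (hw.next y), true == (hw.next y).1.turn) := fun y => rfl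
  rw [this, Equiv.apply_symm_apply, Bool.true_beq]

theorem IsGaussWord.face_false (hw : IsGaussWord w) (x : {x // x ∈ w}) :
    hw.face (hw.next x) false = hw.face (hw.partner x) (!x.1.turn) := by
  refine Quot.sound ?_
  have : ∀ y : {x // x ∈ w}, faceStep hw (y, false) =
      (hw.partner (hw.next.symm y), false == (hw.next.symm y).1.turn) := fun y => rfl
  rw [this, Equiv.symm_apply_apply, Bool.false_beq]

/-- Agreement across edges makes the four corners at each crossing agree, and following the curve
spreads the value to every region. -/
theorem IsGaussWord.const_of_faces (hw : IsGaussWord w) {φ : Face hw → ℚ}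
    (h : ∀ x, φ (hw.face x true) = φ (hw.face (hw.next x) false)) : ∃ k, ∀ F, φ F = k := by
  by_cases hne : Nonempty {x // x ∈ w}
  swap
  · refine ⟨0, fun F => ?_⟩
    obtain ⟨⟨x, d⟩, rfl⟩ := Quot.exists_rep F
    exact absurd ⟨x⟩ hne
  obtain ⟨a⟩ := hne
  have h1 : ∀ y, φ (hw.face (hw.partner y) y.1.turn) = φ (hw.face y false) := fun y => by
    have := h (hw.next.symm y)
    rwa [hw.face_true, Equiv.apply_symm_apply] at this
  have h2 : ∀ y, φ (hw.face y true) = φ (hw.face (hw.partner y) (!y.1.turn)) := fun y => by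
    have := h y
    rwa [hw.face_false] at this
  have h3 : ∀ y, φ (hw.face y true) = φ (hw.face y false) := by
    intro y
    have e1 := h1 y
    have e2 := h2 y
    have e3 := h1 (hw.partner y)
    have e4 := h2 (hw.partner y)
    rw [hw.partner_partner] at e3 e4
    have ht : (hw.partner y).1.turn = !y.1.turn := y.1.turn_partner
    rw [ht] at e3 e4
    cases hy : y.1.turn <;> simp only [hy, Bool.not_true, Bool.not_false] at e1 e2 e3 e4 <;> grind
  have h4 : ∀ y, φ (hw.face y true) = φ (hw.face a true) :=
    hw.next_induction (fun x hx => by rw [h3, ← h x, hx]) rfl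
  refine ⟨φ (hw.face a true), fun F => ?_⟩
  obtain ⟨⟨x, d⟩, rfl⟩ := Quot.exists_rep F
  cases d
  · exact (h3 x).symm.trans (h4 x)
  · exact h4 x

/-- The faces of a planar diagram can be numbered such that the number increases by one whenever an
edge is crossed from the right to the left. -/
theorem IsPlanar.exists_numbering {hw : IsGaussWord w} (hp : IsPlanar hw) (hne : w ≠ []) :
    ∃ φ : Face hw → ℚ, ∀ x, φ (hw.face x true) - φ (hw.face (hw.next x) false) = 1 := by
  classical
  have hE := hp.resolve_left hne
  have : Finite (Face hw) := Quot.finite _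
  have := Fintype.ofFinite (Face hw)
  let lab : {x // x ∈ w} → {l // l ∈ (w.map Passage.label).toFinset} := fun x =>
    ⟨x.1.label, List.mem_toFinset.2 (List.mem_map_of_mem x.2)⟩
  have hlab : ∀ x, lab (hw.partner x) = lab x := fun x => rfl
  -- `d` and `δ` are the coboundary maps from crossings and from faces to edges, where `x` stands
  -- for the edge that follows it.
  let d : ({l // l ∈ (w.map Passage.label).toFinset} → ℚ) →ₗ[ℚ] ({x // x ∈ w} → ℚ) :=
    LinearMap.funLeft ℚ ℚ (fun x => lab (hw.next x)) - LinearMap.funLeft ℚ ℚ lab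
  let δ : (Face hw → ℚ) →ₗ[ℚ] ({x // x ∈ w} → ℚ) :=
    LinearMap.funLeft ℚ ℚ (fun x => hw.face x true) -
      LinearMap.funLeft ℚ ℚ (fun x => hw.face (hw.next x) false)
  have hd : ∀ g x, d g x = g (lab (hw.next x)) - g (lab x) := fun g x => rfl
  have hδ : ∀ φ x, δ φ x = φ (hw.face x true) - φ (hw.face (hw.next x) false) := fun φ x => rfl
  have hdk := card_le_finrank_range_add_one d (by
    intro g hg
    obtain ⟨a, ha⟩ := List.exists_mem_of_ne_nil w hne
    have hc : ∀ x, g (lab x) = g (lab ⟨a, ha⟩) := hw.next_induction (fun x hx => by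
      have := congrFun hg x
      rw [hd, Pi.zero_apply, sub_eq_zero] at this
      exact this.trans hx) rfl
    refine ⟨g (lab ⟨a, ha⟩), fun l => ?_⟩
    obtain ⟨l, hl⟩ := l
    obtain ⟨x, hx, rfl⟩ := List.mem_map.1 (List.mem_toFinset.1 hl)
    exact hc ⟨x, hx⟩)
  have hδk := card_le_finrank_range_add_one δ (by
    intro φ hφ
    refine hw.const_of_faces fun x => ?_
    have := congrFun hφ x
    rwa [hδ, Pi.zero_apply, sub_eq_zero] at this)
  have hcard : Fintype.card {x // x ∈ w} = w.length := by
    rw [Fintype.card_of_subtype w.toFinset (by simp), List.toFinset_card_of_nodup hw.nodup_word]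
  -- summation by parts
  have hparts : ∀ (g : {l // l ∈ (w.map Passage.label).toFinset} → ℚ) (z : {x // x ∈ w} → ℚ),
      ∑ x, d g x * z x = ∑ x, g (lab x) * (z (hw.next.symm x) - z x) := by
    intro g z
    simp only [hd, sub_mul, mul_sub, Finset.sum_sub_distrib]
    congr 1
    rw [← Equiv.sum_comp hw.next.symm]
    simp
  -- The images of `d` and `δ` are orthogonal, of dimensions at least `V - 1` and `F - 1`, which sum
  -- to `E` by Euler's formula. The constant `1` is orthogonal to the image of `d`, since sums
  -- around the closed curve telescope, so it lies in the image of `δ`.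
  have hone : (fun _ => 1 : {x // x ∈ w} → ℚ) ∈ LinearMap.range δ := by
    refine mem_of_orthogonal (U := LinearMap.range d) ?_ ?_ ?_
    · rintro _ ⟨g, rfl⟩ _ ⟨φ, rfl⟩
      rw [hparts]
      -- `s x` adds the values at two diagonally opposite corners; the partner gives the other
      -- diagonal. The difference is antisymmetric under `partner`, so its sum against a function of
      -- the crossing vanishes.
      set s : {x // x ∈ w} → ℚ := fun x => φ (hw.face x true) + φ (hw.face x false)
      have hT : ∀ x, δ φ (hw.next.symm x) - δ φ x = s (hw.partner x) - s x := by
        intro x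
        rw [hδ, hδ, Equiv.apply_symm_apply, hw.face_true, hw.face_false]
        cases x.1.turn <;> simp only [s, Bool.not_true, Bool.not_false] <;> ring
      simp only [hT, mul_sub, Finset.sum_sub_distrib]
      rw [sub_eq_zero, ← Equiv.sum_comp hw.partner]
      simp only [hw.partner_partner, hlab]
    · rw [Nat.card_eq_fintype_card, ← Fintype.card_coe] at hE
      omega
    · rintro _ ⟨g, rfl⟩
      rw [hparts]
      simp
  obtain ⟨φ, hφ⟩ := hone
  exact ⟨φ, fun x => by rw [← hδ, hφ]⟩

end Faces

/-! ### Dependence of the coloring conditions -/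

namespace KnotDiagram

variable {D : KnotDiagram} {R : Type*} [Field R] {m : R}

/-- The exponent of `m` in the edge weights changes along the curve as prescribed by the signs of
the crossings. -/
theorem exists_edge_weights (hm : m ≠ 0) : ∃ W : {x // x ∈ D.word} → R, (∀ x, W x ≠ 0) ∧
    ∀ c : D.Crossing, W (D.isGauss.partner (under c)) = W (under c) * (if c.1.pos then m else m⁻¹)⁻¹ ∧
      W (D.isGauss.next (under c)) = W (under c) * (if c.1.pos then m else m⁻¹)⁻¹ ∧
      W (D.isGauss.next (D.isGauss.partner (under c))) = W (under c) := by
  by_cases hne : D.word = []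
  · have hE : IsEmpty {x // x ∈ D.word} := by rw [hne]; exact ⟨fun x => by simpa using x.2⟩
    exact ⟨fun _ => 1, fun _ => one_ne_zero, fun c => isEmptyElim (under c)⟩
  obtain ⟨φ, hφ⟩ := D.planar.exists_numbering hne
  set h : {x // x ∈ D.word} → ℚ := fun x => φ (D.isGauss.face x false)
  have ht : ∀ x, φ (D.isGauss.face x true) = h (D.isGauss.next x) + 1 := fun x => by
    linear_combination hφ x
  have h1 : ∀ x : {x // x ∈ D.word}, x.1.turn = true →
      h (D.isGauss.next (D.isGauss.partner x)) = h x ∧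
      h (D.isGauss.next x) = h (D.isGauss.partner x) := by
    intro x hx
    have e1 := ht (D.isGauss.next.symm x)
    have e2 : h (D.isGauss.next x) = φ _ := congrArg φ (D.isGauss.face_false x)
    rw [D.isGauss.face_true, Equiv.apply_symm_apply, hx, ht] at e1
    rw [hx] at e2
    exact ⟨by linear_combination e1, e2⟩
  have h2 : ∀ x : {x // x ∈ D.word}, x.1.turn = false → h (D.isGauss.partner x) = h x + 1 := by
    intro x hx
    have e1 := ht (D.isGauss.next.symm x)
    rwa [D.isGauss.face_true, Equiv.apply_symm_apply, hx] at e1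
  -- `h x` is the number of the region to the right of the edge arriving at `x`. It is only
  -- rational, but the steps are integral, so the floor is an integral numbering with the same
  -- steps.
  refine ⟨fun x => m ^ (-⌊h x⌋), fun x => zpow_ne_zero _ hm, fun c => ?_⟩
  set u := under c
  have hp : D.isGauss.partner (D.isGauss.partner u) = u := D.isGauss.partner_partner u
  have htu : u.1.turn = !c.1.pos := by
    have : u.1.isOver = false := under_isOver c
    rw [Passage.turn, this]
    exact Bool.false_beq _
  have htp : (D.isGauss.partner u).1.turn = !u.1.turn := u.1.turn_partner
  cases hc : c.1.pos
  · rw [hc, Bool.not_false] at htu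
    rw [htu, Bool.not_true] at htp
    have e1 := h1 u htu
    have e2 := h2 _ htp
    rw [hp] at e2
    have e3 : ⌊h u⌋ = ⌊h (D.isGauss.partner u)⌋ + 1 := by rw [e2, Int.floor_add_one]
    have e4 : m ^ (-⌊h (D.isGauss.partner u)⌋) = m ^ (-⌊h u⌋) * m := by
      rw [← zpow_add_one₀ hm, e3]; congr 1; ring
    simp [e1.1, e1.2, e4]
  · rw [hc, Bool.not_true] at htu
    rw [htu, Bool.not_false] at htp
    have e1 := h1 _ htp
    have e2 := h2 _ htu
    rw [hp] at e1
    have e3 : ⌊h (D.isGauss.partner u)⌋ = ⌊h u⌋ + 1 := by rw [e2, Int.floor_add_one]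
    have e4 : m ^ (-⌊h (D.isGauss.partner u)⌋) = m ^ (-⌊h u⌋) * m⁻¹ := by
      rw [← zpow_sub_one₀ hm, e3]; congr 1; ring
    refine ⟨by simpa using e4, ?_, ?_⟩
    · simp only [e1.1, if_true]
      exact e4
    · simp only [e1.2]

/-- On a planar diagram, each coloring condition follows from the other ones. -/
theorem isColoring_of_ne (hm : m ≠ 0) (h2 : (2 : R) ≠ 0) {f : D.Arc → R} (r : D.Crossing)
    (h : ∀ c ≠ r, if c.1.pos then f (D.outArc c) = alexanderOp m (f (D.inArc c)) (f (D.overArc c))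
      else f (D.inArc c) = alexanderOp m (f (D.outArc c)) (f (D.overArc c))) :
    D.IsColoring m f := by
  classical
  obtain ⟨W, hW, hc⟩ := exists_edge_weights (D := D) hm
  set q := D.edgeColor f
  -- `T x` is the drop of the weighted color at `x`. The drops telescope to zero around the curve,
  -- and the two at a crossing add up to a unit times the defect of its condition.
  set T : {x // x ∈ D.word} → R := fun x =>
    W x * q x - W (D.isGauss.next x) * q (D.isGauss.next x)
  have hsum : ∑ x, (T x + T (D.isGauss.partner x)) = 0 := by
    have : ∑ x, T x = 0 := by
      rw [Finset.sum_sub_distrib, sub_eq_zero]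
      exact (Equiv.sum_comp D.isGauss.next fun x => W x * q x).symm
    rw [Finset.sum_add_distrib, Equiv.sum_comp D.isGauss.partner T, this, add_zero]
  have hT : ∀ c : D.Crossing, T (under c) + T (D.isGauss.partner (under c)) = 0 ↔
      (if c.1.pos then f (D.outArc c) = alexanderOp m (f (D.inArc c)) (f (D.overArc c))
      else f (D.inArc c) = alexanderOp m (f (D.outArc c)) (f (D.overArc c))) := by
    intro c
    obtain ⟨e1, e2, e3⟩ := hc c
    have e4 : q (D.isGauss.next (D.isGauss.partner (under c))) = q (D.isGauss.partner (under c)) :=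
      edgeColor_next_of_isOver f (by simp [IsGaussWord.partner, Passage.partner, under_isOver])
    simp only [T, e1, e2, e3, e4]
    rw [inArc_eq f c, outArc_eq f c, overArc_eq f c]
    have hW0 := hW (under c)
    have key : ∀ μ x y z : R, μ ≠ 0 → (W (under c) * x - W (under c) * μ⁻¹ * z +
        (W (under c) * μ⁻¹ * y - W (under c) * y) = 0 ↔ z = alexanderOp μ x y) := by
      intro μ x y z hμ
      have : W (under c) * x - W (under c) * μ⁻¹ * z + (W (under c) * μ⁻¹ * y - W (under c) * y) =
          W (under c) * μ⁻¹ * (alexanderOp μ x y - z) := by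
        unfold alexanderOp; field_simp; ring
      rw [this, mul_eq_zero, sub_eq_zero]
      simp [hW0, hμ, eq_comm]
    split_ifs
    · exact key m _ _ _ hm
    · rw [← eq_alexanderOp_inv_iff hm]
      exact key _ _ _ _ (inv_ne_zero hm)
  intro c
  by_cases hcr : c = r
  · subst hcr
    rw [← hT]
    -- Only the two passages of the exceptional crossing remain, with equal terms; this is where `2
    -- ≠ 0` enters.
    rw [Fintype.sum_eq_add (under c) (D.isGauss.partner (under c)), D.isGauss.partner_partner,
      add_comm (T (D.isGauss.partner _)), ← two_mul] at hsum
    · exact (mul_eq_zero.1 hsum).resolve_left h2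
    · intro heq
      have := congrArg (fun x => x.1.isOver) heq
      simp [IsGaussWord.partner, Passage.partner] at this
    · rintro x ⟨hx1, hx2⟩
      cases hx : x.1.isOver
      · obtain ⟨d, rfl⟩ := exists_under_eq hx
        exact (hT d).2 (h d (by rintro rfl; exact hx1 rfl))
      · obtain ⟨d, hd⟩ := exists_under_eq (x := D.isGauss.partner x)
          (by simp [IsGaussWord.partner, Passage.partner, hx])
        have hd' : x = D.isGauss.partner (under d) := by rw [hd, D.isGauss.partner_partner]
        rw [hd', D.isGauss.partner_partner, add_comm]
        exact (hT d).2 (h d (by rintro rfl; exact hx2 hd'))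
  · exact h c hcr

omit [Field R] in
/-- If the operation is trivial, the conditions at all crossings but one leave only constant
colorings, as the diagram has one component. -/
theorem eq_of_isColoring_one_of_ne {f : D.Arc → R} (r : D.Crossing)
    (h : ∀ c ≠ r, f (D.outArc c) = f (D.inArc c)) (a b : D.Arc) : f a = f b := by
  have hq : ∀ x, D.edgeColor f x = f r := by
    refine D.isGauss.next_induction (a := D.isGauss.next (under r)) (fun x hx => ?_)
      (edgeColor_next f r)
    cases hxo : x.1.isOver
    · obtain ⟨c, rfl⟩ := exists_under_eq hxo
      by_cases hcr : c = r
      · subst hcr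
        exact edgeColor_next f c
      · rw [← outArc_eq f c, h c hcr]
        exact hx
    · rw [edgeColor_next_of_isOver f hxo, hx]
  rw [eq_const_of_edgeColor hq a, eq_const_of_edgeColor hq b]

end KnotDiagram

/-! ### Determinants of difference matrices -/

section DeterminantBound

open Matrix

/-- The matrix whose rows are differences `e_x - e_y` of unit vectors, where `none` stands for a
deleted column. -/
def differenceMatrix {ι : Type*} {κ : Type*} [DecidableEq κ] (x y : ι → Option κ) : Matrix ι κ ℤ :=
  fun i j => (if x i = some j then 1 else 0) - (if y i = some j then 1 else 0)

/-- If the first row is `e_c - e_o`, the determinant can be computed, up to sign, after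
identification of the columns `c` and `o`. -/
theorem exists_abs_det_differenceMatrix_eq {n : ℕ} (x y : Fin (n + 1) → Option (Fin (n + 1)))
    {c : Fin (n + 1)} (hx : x 0 = some c) (hy : y 0 ≠ some c) :
    ∃ x' y' : Fin n → Option (Fin n),
      |(differenceMatrix x y).det| = |(differenceMatrix x' y').det| := by
  set o := y 0 with ho
  -- `f` redirects column `c` to `o` and renumbers the columns other than `c`: an edge contraction.
  let f : Option (Fin (n + 1)) → Option (Fin n) := fun t =>
    if t = some c then o.bind (finSuccEquiv' c) else t.bind (finSuccEquiv' c)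
  have hf : ∀ t j, (if f t = some j then (1 : ℤ) else 0) = (if t = some (c.succAbove j) then 1 else 0)
      + (if o = some (c.succAbove j) then 1 else 0) * (if t = some c then 1 else 0) := by
    have hb : ∀ t j, t.bind (finSuccEquiv' c) = some j ↔ t = some (c.succAbove j) := by
      intro t j
      rw [Option.bind_eq_some_iff]
      simp only [finSuccEquiv'_eq_some]
      constructor
      · rintro ⟨a, rfl, rfl⟩; rfl
      · rintro rfl; exact ⟨_, rfl, rfl⟩
    intro t j
    by_cases ht : t = some c
    · subst ht
      simp [f, hb, (Fin.succAbove_ne c j).symm]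
    · simp [f, ht, hb]
  refine ⟨fun i => f (x i.succ), fun i => f (y i.succ), ?_⟩
  -- Adding column `c` to column `o` turns the first row into the unit vector at `c`; Laplace
  -- expansion then leaves the contracted matrix.
  let B : Matrix (Fin (n + 1)) (Fin (n + 1)) ℤ := fun i j =>
    differenceMatrix x y i j + (if o = some j then 1 else 0) * differenceMatrix x y i c
  have hB : B.det = (differenceMatrix x y).det :=
    by
      rw [← Matrix.det_transpose, ← Matrix.det_transpose (differenceMatrix x y)]
      exact Matrix.det_eq_of_forall_row_eq_smul_add_const (fun j => if o = some j then 1 else 0) c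
        (by simp [hy]) fun i j => rfl
  have hrow : ∀ j, B 0 j = if j = c then 1 else 0 := by
    intro j
    simp only [B, differenceMatrix, hx, ← ho, hy, Option.some.injEq]
    by_cases hj : j = c
    · subst hj; simp [hy]
    · simp [hj, Ne.symm hj]
  have hminor : B.submatrix Fin.succ c.succAbove =
      differenceMatrix (fun i => f (x i.succ)) fun i => f (y i.succ) := by
    ext i j
    rw [Matrix.submatrix_apply]
    simp only [B, differenceMatrix, hf]
    ring
  rw [← hB, Matrix.det_succ_row_zero, Finset.sum_eq_single c]
  · rw [hrow, if_pos rfl, hminor, abs_mul, abs_mul, abs_pow]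
    simp
  · intro j _ hj
    rw [hrow, if_neg hj]
    simp
  · simp

/-- These are incidence matrices of graphs with one vertex deleted, so the determinant is `0` or
`±1`: a loop gives a zero row, and any other edge can be contracted. -/
theorem abs_det_differenceMatrix_le (n : ℕ) (x y : Fin n → Option (Fin n)) :
    |(differenceMatrix x y).det| ≤ 1 := by
  induction n with
  | zero => simp
  | succ n ih =>
    by_cases hxy : x 0 = y 0
    · rw [Matrix.det_eq_zero_of_row_eq_zero 0 fun j => by simp [differenceMatrix, hxy]]
      simp
    · cases hx : x 0 with
      | some c =>
        obtain ⟨x', y', h⟩ := exists_abs_det_differenceMatrix_eq x y hx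
          (fun h => hxy (hx.trans h.symm))
        rw [h]
        exact ih x' y'
      | none =>
        cases hy : y 0 with
        | none => exact absurd (hx.trans hy.symm) hxy
        | some c =>
          obtain ⟨x', y', h⟩ := exists_abs_det_differenceMatrix_eq y x hy (by rw [hx]; simp)
          have hneg : differenceMatrix x y = -differenceMatrix y x := by
            ext i j; simp [differenceMatrix]
          rw [hneg, Matrix.det_neg, abs_mul, abs_pow, abs_neg, abs_one, one_pow, one_mul, h]
          exact ih x' y'

/-- A square matrix with rows `m e_x - (m - 1) e_y - e_z`, where unit vectors may be replaced by
zero, has a determinant of absolute value at most `m ^ n`. -/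
theorem abs_det_le_pow (n : ℕ) (m : ℕ) (hm : 0 < m) (x y z : Fin n → Option (Fin n))
    (A : Matrix (Fin n) (Fin n) ℤ)
    (hA : ∀ i j, A i j = (m : ℤ) * (if x i = some j then 1 else 0) +
      (1 - (m : ℤ)) * (if y i = some j then 1 else 0) - (if z i = some j then 1 else 0)) :
    |A.det| ≤ (m : ℤ) ^ n := by
  obtain ⟨k, rfl⟩ : ∃ k, m = k + 1 := ⟨m - 1, by omega⟩
  -- Each row is split into `m = k + 1` differences: `none` gives `e_x - e_z`, each of the other `k`
  -- choices gives `e_x - e_y`.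
  let g : Fin n → Option (Fin k) → Fin n → ℤ := fun i o j =>
    (if x i = some j then 1 else 0) - (if o.elim (z i) (fun _ => y i) = some j then 1 else 0)
  have hA' : A = fun i => ∑ o, g i o := by
    funext i j
    rw [hA, Finset.sum_apply, Fintype.sum_option]
    have h0 : g i none j = (if x i = some j then 1 else 0) - (if z i = some j then 1 else 0) := rfl
    have h1 : ∀ o : Fin k, g i (some o) j =
      (if x i = some j then 1 else 0) - (if y i = some j then 1 else 0) := fun _ => rfl
    simp only [h0, h1, Finset.sum_const, Finset.card_univ, Fintype.card_fin, nsmul_eq_mul]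
    push_cast
    ring
  have h1 : A.det = ∑ r : Fin n → Option (Fin k),
      (differenceMatrix x fun i => (r i).elim (z i) fun _ => y i).det := by
    rw [hA']
    exact MultilinearMap.map_sum (Matrix.detRowAlternating (R := ℤ) (n := Fin n)).toMultilinearMap g
  rw [h1]
  refine (Finset.abs_sum_le_sum_abs _ _).trans ?_
  refine (Finset.sum_le_sum fun r _ => abs_det_differenceMatrix_le n _ _).trans ?_
  simp

end DeterminantBound

/-! ### The linear system after identification of equal colors -/

section ColorIdentification

open Matrix

theorem sum_ite_mul_eq_elim {R : Type*} [CommRing R] {n : ℕ} (t : Option (Fin n)) (g : Fin n → R) :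
    ∑ j, (if t = some j then 1 else 0) * g j = t.elim 0 g := by
  cases t <;> simp

theorem sum_coloring_row {R : Type*} [CommRing R] {n : ℕ} (m : R) (x y z : Option (Fin n))
    (g : Fin n → R) :
    ∑ j, (m * (if x = some j then 1 else 0) + (1 - m) * (if y = some j then 1 else 0) -
      (if z = some j then 1 else 0)) * g j =
    alexanderOp m (x.elim 0 g) (y.elim 0 g) - z.elim 0 g := by
  simp only [sub_mul (_ + _), add_mul, Finset.sum_sub_distrib, Finset.sum_add_distrib, mul_assoc,
    ← Finset.mul_sum, sum_ite_mul_eq_elim, alexanderOp]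

/-- A system of coloring conditions in `n + 1` unknowns that has only constant rational solutions,
but a non-constant solution modulo `p`. -/
theorem le_pow_of_solutions {C S : Type*} [Finite C] [Fintype S] {n m p : ℕ} (hp : p.Prime)
    (hm : 0 < m) (hS : Fintype.card S = n + 1) (x y z : C → S)
    (hQ : ∀ g : S → ℚ, (∀ c, g (z c) = alexanderOp (m : ℚ) (g (x c)) (g (y c))) →
      ∀ a b, g a = g b)
    (v : S → ZMod p) (hv : ∀ c, v (z c) = alexanderOp (m : ZMod p) (v (x c)) (v (y c)))
    (hne : ∃ a b, v a ≠ v b) : p ≤ m ^ n := by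
  have := Fact.mk hp
  have := Fintype.ofFinite C
  -- The color sent to `none` is normalized to zero, which removes the constant solutions.
  obtain ⟨e⟩ : Nonempty (S ≃ Option (Fin n)) := Fintype.card_eq.1 (by simp [hS])
  let A : Matrix C (Fin n) ℤ := fun c j => (m : ℤ) * (if e (x c) = some j then 1 else 0) +
      (1 - (m : ℤ)) * (if e (y c) = some j then 1 else 0) - (if e (z c) = some j then 1 else 0)
  have hmul : ∀ {R : Type} [CommRing R] (g : Fin n → R) (c : C),
      ∑ j, (A c j : R) * g j = alexanderOp (m : R) ((e (x c)).elim 0 g) ((e (y c)).elim 0 g) -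
        (e (z c)).elim 0 g := by
    intro R _ g c
    rw [← sum_coloring_row]
    refine Finset.sum_congr rfl fun j _ => ?_
    simp only [A]
    push_cast
    rfl
  set M : Matrix C (Fin n) ℚ := A.map (Int.cast : ℤ → ℚ)
  have hinj : Function.Injective M.mulVecLin := by
    rw [← LinearMap.ker_eq_bot, LinearMap.ker_eq_bot']
    intro g hg
    have h := hQ (fun s => (e s).elim 0 g) fun c => by
      have := congrFun hg c
      rw [Matrix.mulVecLin_apply, Matrix.mulVec, dotProduct, Pi.zero_apply] at this
      simp only [M, Matrix.map_apply, hmul, sub_eq_zero] at this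
      exact this.symm
    funext j
    simpa using h (e.symm (some j)) (e.symm none)
  have hrank : M.rank = n := by
    rw [Matrix.rank, LinearMap.finrank_range_of_inj hinj]
    simp
  rw [Matrix.rank_eq_finrank_span_row] at hrank
  -- The columns are independent over `ℚ`, so `n` independent rows can be selected for a non-zero
  -- minor.
  obtain ⟨f, hf, -, hlin⟩ := Submodule.exists_fun_fin_finrank_span_eq ℚ (Set.range M.row)
  choose c hc using hf
  set r : Fin n → C := fun i => c (Fin.cast hrank.symm i)
  have hdet : (A.submatrix r id).det ≠ 0 := by
    have h1 : LinearIndependent ℚ ((A.submatrix r id).map (Int.cast : ℤ → ℚ)).row := by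
      have : ((A.submatrix r id).map (Int.cast : ℤ → ℚ)).row = f ∘ Fin.cast hrank.symm := by
        funext i
        exact hc (Fin.cast hrank.symm i)
      rw [this]
      exact hlin.comp _ (Fin.cast_injective _)
    rw [Matrix.linearIndependent_rows_iff_isUnit, Matrix.isUnit_iff_isUnit_det,
      isUnit_iff_ne_zero] at h1
    intro h0
    refine h1 ?_
    have := (Int.castRingHom ℚ).map_det (A.submatrix r id)
    rw [h0, map_zero] at this
    exact this.symm
  have hmod : (((A.submatrix r id).det : ℤ) : ZMod p) = 0 := by
    have h1 : (((A.submatrix r id).det : ℤ) : ZMod p) =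
        ((A.submatrix r id).map (Int.cast : ℤ → ZMod p)).det :=
      (Int.castRingHom (ZMod p)).map_det (A.submatrix r id)
    rw [h1]
    -- Translating `v` to vanish at the normalized color gives a non-zero kernel vector modulo `p`.
    refine Matrix.exists_mulVec_eq_zero_iff.1
      ⟨fun j => v (e.symm (some j)) - v (e.symm none), fun h0 => ?_, ?_⟩
    · have hconst : ∀ s, v s = v (e.symm none) := by
        intro s
        obtain ⟨t, rfl⟩ := e.symm.surjective s
        cases t with
        | none => rfl
        | some j => exact sub_eq_zero.1 (congrFun h0 j)
      obtain ⟨a, b, hab⟩ := hne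
      exact hab ((hconst a).trans (hconst b).symm)
    · have helim : ∀ s, (e s).elim 0 (fun j => v (e.symm (some j)) - v (e.symm none)) =
          v s - v (e.symm none) := by
        intro s
        obtain ⟨t, rfl⟩ := e.symm.surjective s
        cases t <;> simp
      funext i
      rw [Matrix.mulVec, dotProduct, Pi.zero_apply]
      simp only [Matrix.map_apply, Matrix.submatrix_apply, id, hmul, helim, hv]
      unfold alexanderOp
      ring
  have hdvd := Int.le_of_dvd (abs_pos.2 hdet)
    ((dvd_abs _ _).2 ((ZMod.intCast_zmod_eq_zero_iff_dvd _ _).1 hmod))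
  have hle := abs_det_le_pow n m hm (fun i => e (x (r i))) (fun i => e (y (r i)))
    (fun i => e (z (r i))) (A.submatrix r id) fun i j => rfl
  exact_mod_cast hdvd.trans hle

end ColorIdentification

/-! ### Size of a polynomial at a large integer -/

section Evaluation

open Polynomial

/-- Horner's scheme: if `P = X Q + c` and `Q(m) ≥ 1`, then `P(m) ≥ m + c ≥ 1`. -/
theorem eval_pos_of_coeff_le {m : ℤ} (hm : 0 < m) (n : ℕ) : ∀ {P : ℤ[X]}, P.natDegree ≤ n →
    0 < P.leadingCoeff → (∀ i, |P.coeff i| ≤ m - 1) → 0 < P.eval m := by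
  induction n with
  | zero =>
    intro P hP hl hc
    rw [Polynomial.eq_C_of_natDegree_le_zero hP, leadingCoeff_C] at hl
    rw [Polynomial.eq_C_of_natDegree_le_zero hP, eval_C]
    exact hl
  | succ n ih =>
    intro P hP hl hc
    by_cases h0 : P.natDegree = 0
    · rw [Polynomial.eq_C_of_natDegree_eq_zero h0, leadingCoeff_C] at hl
      rw [Polynomial.eq_C_of_natDegree_eq_zero h0, eval_C]
      exact hl
    · have hd : (divX P).natDegree = P.natDegree - 1 := natDegree_divX_eq_natDegree_tsub_one
      have := ih (P := divX P) (by omega)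
        (by rwa [leadingCoeff, coeff_divX, hd, Nat.sub_add_cancel (by omega)])
        (fun i => by rw [coeff_divX]; exact hc _)
      rw [← divX_mul_X_add P, eval_add, eval_mul, eval_X, eval_C]
      have h1 := (abs_le.1 (hc 0)).1
      nlinarith

variable {P : ℤ[X]} {m : ℤ}

theorem leadingCoeff_pos_of_eval_pos (hm : 0 < m) (hc : ∀ i, |P.coeff i| + 1 < m)
    (hP : 0 < P.eval m) : 0 < P.leadingCoeff := by
  by_contra! hl
  rcases hl.lt_or_eq with hl | hl
  · have := eval_pos_of_coeff_le hm _ (P := -P) le_rfl (by rw [leadingCoeff_neg]; omega)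
      (fun i => by rw [coeff_neg, abs_neg]; have := hc i; omega)
    rw [eval_neg] at this
    omega
  · rw [leadingCoeff_eq_zero] at hl
    simp [hl] at hP

theorem lt_eval_of_coeff_lt (hc : ∀ i, |P.coeff i| + 1 < m) (h0 : 0 < P.coeff 0)
    (hl : 0 < P.leadingCoeff) (hd : P.natDegree ≠ 0) : m < P.eval m := by
  have hm : 0 < m := by have := hc 0; have := abs_nonneg (P.coeff 0); omega
  have hd' : (divX P).natDegree = P.natDegree - 1 := natDegree_divX_eq_natDegree_tsub_one
  have := eval_pos_of_coeff_le hm _ (P := divX P) le_rfl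
    (by rwa [leadingCoeff, coeff_divX, hd', Nat.sub_add_cancel (by omega)])
    (fun i => by rw [coeff_divX]; have := hc (i + 1); omega)
  rw [← divX_mul_X_add P, eval_add, eval_mul, eval_X, eval_C]
  nlinarith

/-- The slack of one in the bound on the coefficients is what allows a monomial to be subtracted
while positivity at `m` still applies. -/
theorem abs_coeff_sub_X_pow_le (hc : ∀ i, |P.coeff i| + 1 < m) (j i : ℕ) :
    |(P - X ^ j).coeff i| ≤ m - 1 := by
  rw [coeff_sub, coeff_X_pow]
  refine (abs_sub _ _).trans ?_
  have := hc i
  split_ifs <;> simp <;> omega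

theorem pow_pred_lt_eval (hc : ∀ i, |P.coeff i| + 1 < m) (hl : 0 < P.leadingCoeff)
    (hd : P.natDegree ≠ 0) : m ^ (P.natDegree - 1) < P.eval m := by
  have hm : 0 < m := by have := hc 0; have := abs_nonneg (P.coeff 0); omega
  have hdeg : degree (X ^ (P.natDegree - 1) : ℤ[X]) < degree P := by
    rw [degree_X_pow, degree_eq_natDegree (by rintro rfl; simp at hd)]
    exact_mod_cast Nat.sub_lt (Nat.pos_of_ne_zero hd) one_pos
  have := eval_pos_of_coeff_le hm _ (P := P - X ^ (P.natDegree - 1)) le_rfl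
    (by rwa [leadingCoeff_sub_of_degree_lt hdeg]) (abs_coeff_sub_X_pow_le hc _)
  rw [eval_sub, eval_pow, eval_X] at this
  omega

/-- `P - X ^ k` still has a positive leading coefficient: `c_k - 1` if `c_k > 1`, and the
penultimate coefficient if `c_k = 1`. -/
theorem pow_natDegree_lt_eval (hc : ∀ i, |P.coeff i| + 1 < m) (hl : 0 < P.leadingCoeff)
    (h : 1 < P.leadingCoeff ∨ 0 < P.eraseLead.leadingCoeff) : m ^ P.natDegree < P.eval m := by
  have hm : 0 < m := by have := hc 0; have := abs_nonneg (P.coeff 0); omega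
  have hlead : 0 < (P - X ^ P.natDegree).leadingCoeff := by
    by_cases h1 : P.leadingCoeff = 1
    · have h2 := P.eraseLead_add_C_mul_X_pow
      rw [h1, C_1, one_mul] at h2
      have h3 : P - X ^ P.natDegree = P.eraseLead := by linear_combination -h2
      rw [h3]
      exact h.resolve_left (by omega)
    · have hco : (P - X ^ P.natDegree).coeff P.natDegree = P.leadingCoeff - 1 := by simp
      have hle : (P - X ^ P.natDegree).natDegree ≤ P.natDegree :=
        (natDegree_sub_le _ _).trans (by simp)
      have hnd : (P - X ^ P.natDegree).natDegree = P.natDegree :=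
        hle.antisymm (le_natDegree_of_ne_zero (by rw [hco]; omega))
      rw [leadingCoeff, hnd, hco]
      omega
  have := eval_pos_of_coeff_le hm _ le_rfl hlead (abs_coeff_sub_X_pow_le hc _)
  rw [eval_sub, eval_pow, eval_X] at this
  omega

end Evaluation

/-! ### Minors of the Alexander matrix and colorings -/

namespace KnotDiagram

variable {D : KnotDiagram} {R : Type*} [Field R] {m : R}

open LaurentPolynomial

/-- The coloring condition at one crossing. -/
def ColorsCrossing (D : KnotDiagram) (m : R) (f : D.Arc → R) (c : D.Crossing) : Prop :=
  if c.1.pos then f (D.outArc c) = alexanderOp m (f (D.inArc c)) (f (D.overArc c))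
    else f (D.inArc c) = alexanderOp m (f (D.outArc c)) (f (D.overArc c))

/-- The rows of the Alexander matrix, evaluated at `m`, express the coloring conditions. -/
theorem sum_alexanderMatrix_eq_zero_iff (u : Rˣ) (f : D.Arc → R) (c : D.Crossing) :
    ∑ a, eval₂ (Int.castRingHom R) u (D.alexanderMatrix c a) * f a = 0 ↔
      D.ColorsCrossing (u : R) f c := by
  have h : ∑ a, eval₂ (Int.castRingHom R) u (D.alexanderMatrix c a) * f a =
      alexanderOp (u : R) (f (if c.1.pos then D.inArc c else D.outArc c)) (f (D.overArc c)) -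
        f (if c.1.pos then D.outArc c else D.inArc c) := by
    simp only [alexanderMatrix, map_add, map_sub, apply_ite (eval₂ (Int.castRingHom R) u), map_zero,
      map_one, eval₂_T, zpow_one, add_mul, sub_mul, ite_mul, zero_mul, one_mul,
      Finset.sum_add_distrib, Finset.sum_sub_distrib, Finset.sum_ite_eq',
      Finset.mem_univ, if_true, alexanderOp]
  rw [h, sub_eq_zero, ColorsCrossing]
  split_ifs <;> exact eq_comm

/-- The minor of the Alexander matrix vanishes at `m` if and only if there is a non-zero assignment
that vanishes on the deleted arc and satisfies the conditions at the remaining crossings. -/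
theorem eval_minor_eq_zero_iff (u : Rˣ) (r : D.Crossing) (s : D.Arc)
    (e : {c : D.Crossing // c ≠ r} ≃ {a : D.Arc // a ≠ s}) :
    eval₂ (Int.castRingHom R) u
      (D.alexanderMatrix.submatrix (fun i => i.1) (fun i => (e i).1)).det = 0 ↔
    ∃ f : D.Arc → R, f s = 0 ∧ (∃ a, f a ≠ 0) ∧ ∀ c ≠ r, D.ColorsCrossing (u : R) f c := by
  rw [RingHom.map_det, ← Matrix.exists_mulVec_eq_zero_iff]
  have hsum : ∀ (f : D.Arc → R) (c : {c : D.Crossing // c ≠ r}), f s = 0 →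
      ((eval₂ (Int.castRingHom R) u).mapMatrix
        (D.alexanderMatrix.submatrix (fun i => i.1) (fun i => (e i).1))).mulVec
          (fun i => f (e i).1) c =
      ∑ a, eval₂ (Int.castRingHom R) u (D.alexanderMatrix c.1 a) * f a := by
    intro f c hf
    rw [Matrix.mulVec, dotProduct]
    simp only [RingHom.mapMatrix_apply, Matrix.map_apply, Matrix.submatrix_apply]
    rw [Equiv.sum_comp e fun a =>
      eval₂ (Int.castRingHom R) u (D.alexanderMatrix c.1 a.1) * f a.1]
    rw [← Finset.add_sum_erase Finset.univ (fun a =>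
      eval₂ (Int.castRingHom R) u (D.alexanderMatrix c.1 a) * f a) (Finset.mem_univ s)]
    simp only [hf, mul_zero, zero_add]
    exact (Finset.sum_subtype (Finset.univ.erase s) (by simp) (fun a =>
      eval₂ (Int.castRingHom R) u (D.alexanderMatrix c.1 a) * f a)).symm
  constructor
  · rintro ⟨g, hg, hM⟩
    let f : D.Arc → R := fun a => if h : a ≠ s then g (e.symm ⟨a, h⟩) else 0
    have hfs : f s = 0 := dif_neg (not_not.2 rfl)
    have hfg : (fun i => f (e i).1) = g := by
      funext i
      simp only [f, dif_pos (e i).2, Subtype.coe_eta, Equiv.symm_apply_apply]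
    refine ⟨f, hfs, ?_, fun c hc => ?_⟩
    · by_contra! h
      exact hg (by rw [← hfg]; exact funext fun i => h _)
    · rw [← sum_alexanderMatrix_eq_zero_iff, ← hsum f ⟨c, hc⟩ hfs, hfg, hM]
      rfl
  · rintro ⟨f, hfs, ⟨a, ha⟩, hf⟩
    refine ⟨fun i => f (e i).1, fun h => ?_, funext fun c => ?_⟩
    · have := congrFun h (e.symm ⟨a, by rintro rfl; exact ha hfs⟩)
      simp only [Equiv.apply_symm_apply] at this
      exact ha this
    · rw [hsum f c hfs, Pi.zero_apply, sum_alexanderMatrix_eq_zero_iff]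
      exact hf c.1 c.2

end KnotDiagram

/-! ### From the Alexander polynomial to the bounds -/

theorem alexanderOp_sub {R : Type*} [CommRing R] (m x y k : R) :
    alexanderOp m (x - k) (y - k) = alexanderOp m x y - k := by unfold alexanderOp; ring

/-- If the reduced Alexander polynomial does not vanish at `m`, there are only constant colorings. -/
theorem Knot.IsReducedAlexanderPolynomial.onlyConst {K : Knot} {P : Polynomial ℤ}
    (hP : K.IsReducedAlexanderPolynomial P) {R : Type*} [Field R] (u : Rˣ)
    (h : P.eval₂ (Int.castRingHom R) u ≠ 0) {E : KnotDiagram} (hE : E.IsDiagramOf K) :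
    OnlyConst (u : R) E.word := by
  obtain ⟨-, D, hD, r, s, e, ε, n, hdet⟩ := hP
  rw [← KnotDiagram.onlyConst_iff u.ne_zero hD hE]
  refine KnotDiagram.onlyConst_of_forall u.ne_zero fun f hf a b => ?_
  by_contra hab
  refine h ?_
  -- Subtracting the constant `f s` preserves the conditions and makes the assignment vanish on the
  -- deleted arc.
  have h0 := (KnotDiagram.eval_minor_eq_zero_iff u r s e).2 ⟨fun a => f a - f s, sub_self _, ?_, ?_⟩
  · rw [hdet, map_mul, map_mul, LaurentPolynomial.eval₂_toLaurent, LaurentPolynomial.eval₂_C,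
      LaurentPolynomial.eval₂_T] at h0
    refine (mul_eq_zero.1 h0).resolve_left (mul_ne_zero ?_ (Units.ne_zero _))
    exact (ε.isUnit.map (Int.castRingHom R)).ne_zero
  · by_contra! hc
    exact hab ((sub_eq_zero.1 (hc a)).trans (sub_eq_zero.1 (hc b)).symm)
  · intro c _
    have := hf c
    unfold KnotDiagram.ColorsCrossing
    simpa only [alexanderOp_sub, sub_left_inj] using this

/-- If the reduced Alexander polynomial vanishes at `m`, some diagram has an assignment that
satisfies the coloring conditions except at one crossing. -/
theorem Knot.IsReducedAlexanderPolynomial.exists_nonconst {K : Knot} {P : Polynomial ℤ}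
    (hP : K.IsReducedAlexanderPolynomial P) {R : Type*} [Field R] (u : Rˣ)
    (h : P.eval₂ (Int.castRingHom R) u = 0) :
    ∃ D : KnotDiagram, D.IsDiagramOf K ∧ ∃ (r : D.Crossing) (f : D.Arc → R),
      (∃ a b, f a ≠ f b) ∧ ∀ c ≠ r, D.ColorsCrossing (u : R) f c := by
  obtain ⟨-, D, hD, r, s, e, ε, n, hdet⟩ := hP
  obtain ⟨f, hfs, ⟨a, ha⟩, hf⟩ := (KnotDiagram.eval_minor_eq_zero_iff u r s e).1 (by
    rw [hdet, map_mul, LaurentPolynomial.eval₂_toLaurent, h, mul_zero])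
  exact ⟨D, hD, r, f, ⟨a, s, by rwa [hfs]⟩, hf⟩

/-- A constant prime polynomial is not the Alexander polynomial of a knot. -/
theorem Knot.IsReducedAlexanderPolynomial.natDegree_ne_zero {K : Knot} {P : Polynomial ℤ}
    (hP : K.IsReducedAlexanderPolynomial P) {p : ℕ} (hp : p.Prime) {m : ℤ}
    (hpm : (p : ℤ) = P.eval m) : P.natDegree ≠ 0 := by
  intro hd
  have := Fact.mk hp
  rw [Polynomial.eq_C_of_natDegree_eq_zero hd, Polynomial.eval_C] at hpm
  -- A constant `P` equals `p`, so it vanishes modulo `p` even at `t = 1`, where the operation is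
  -- trivial and a one-component diagram admits only constant assignments.
  obtain ⟨D, -, r, f, ⟨a, b, hab⟩, hf⟩ := hP.exists_nonconst (R := ZMod p) 1 (by
    rw [Polynomial.eq_C_of_natDegree_eq_zero hd, Polynomial.eval₂_C, ← hpm]
    simp)
  refine hab (KnotDiagram.eq_of_isColoring_one_of_ne r (fun c hc => ?_) a b)
  have := hf c hc
  unfold KnotDiagram.ColorsCrossing at this
  simp only [Units.val_one, alexanderOp, one_mul, sub_self, zero_mul, add_zero] at this
  split_ifs at this
  · exact this
  · exact this.symm

theorem theorem1p1 (K : Knot) (P : Polynomial ℤ) (hP : K.IsReducedAlexanderPolynomial P)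
    (m : ℤ) (hm : ∀ i ≤ P.natDegree, |P.coeff i| + 1 < m)
    (p : ℕ) (hp : p.Prime) (hodd : Odd p) (hpm : (p : ℤ) = P.eval m) :
    (P.leadingCoeff = 1 ∧ P.eraseLead.leadingCoeff < 0 →
      P.natDegree + 1 ≤ Knot.mincol p m K) ∧
    (1 < P.leadingCoeff ∨ 0 < P.eraseLead.leadingCoeff →
      P.natDegree + 2 ≤ Knot.mincol p m K) := by
  have := Fact.mk hp
  have hm1 : 1 < m := by have := hm 0 (Nat.zero_le _); have := abs_nonneg (P.coeff 0); omega
  have hc : ∀ i, |P.coeff i| + 1 < m := by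
    intro i
    by_cases hi : i ≤ P.natDegree
    · exact hm i hi
    · rw [Polynomial.coeff_eq_zero_of_natDegree_lt (by omega)]
      simpa using hm1
  have hd : P.natDegree ≠ 0 := hP.natDegree_ne_zero hp hpm
  have hpos : 0 < P.eval m := by rw [← hpm]; exact_mod_cast hp.pos
  have hl := leadingCoeff_pos_of_eval_pos (by omega) hc hpos
  -- Together with `P(m) = p` this gives `m < p`, so `m` is invertible modulo `p`.
  have hlt := lt_eval_of_coeff_lt hc hP.1 hl hd
  obtain ⟨k, rfl⟩ : ∃ k : ℕ, m = k := ⟨m.toNat, by omega⟩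
  have hk1 : 1 < k := by exact_mod_cast hm1
  have hkp : (k : ZMod p) ≠ 0 := by
    rw [Ne, ZMod.natCast_eq_zero_iff]
    intro hdvd
    have := Nat.le_of_dvd (by omega) hdvd
    rw [← hpm] at hlt
    omega
  have h2 : (2 : ZMod p) ≠ 0 := by
    intro h
    have h3 : ((2 : ℕ) : ZMod p) = 0 := by exact_mod_cast h
    rw [ZMod.natCast_eq_zero_iff] at h3
    have := Nat.le_of_dvd two_pos h3
    have := hp.two_le
    obtain ⟨j, hj⟩ := hodd
    omega
  -- non-trivial colorings exist
  have hne : {q : ℕ | ∃ D : KnotDiagram, D.IsDiagramOf K ∧ ∃ f : D.Arc → ZMod p,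
      D.IsColoring (((k : ℕ) : ℤ) : ZMod p) f ∧ (∃ a b, f a ≠ f b) ∧
        (Set.range f).ncard = q}.Nonempty := by
    obtain ⟨D, hD, r, f, hf, hcol⟩ := hP.exists_nonconst (Units.mk0 (k : ZMod p) hkp) (by
      have := congrArg (Int.castRingHom (ZMod p)) hpm
      rw [← Polynomial.eval₂_at_apply] at this
      simpa using this.symm)
    refine ⟨_, D, hD, f, ?_, hf, rfl⟩
    rw [Int.cast_natCast]
    exact KnotDiagram.isColoring_of_ne hkp h2 r hcol
  -- every non-trivial coloring uses many colors
  have key : ∃ n, Knot.mincol p k K = n + 1 ∧ p ≤ k ^ n := by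
    obtain ⟨D, hD, f, hf, ⟨a, b, hab⟩, hq⟩ := Nat.sInf_mem hne
    rw [Int.cast_natCast] at hf
    have hconst : OnlyConst (k : ℚ) D.word := by
      refine hP.onlyConst (Units.mk0 (k : ℚ) (by positivity)) ?_ hD
      have h := Polynomial.eval₂_at_apply (p := P) (Int.castRingHom ℚ) (k : ℤ)
      simp only [eq_intCast, Int.cast_natCast] at h
      rw [Units.val_mk0, h]
      exact_mod_cast hpos.ne'
    have hcard : 0 < (Set.range f).ncard := (Set.ncard_pos (Set.toFinite _)).2 ⟨_, a, rfl⟩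
    obtain ⟨n, hn⟩ : ∃ n, (Set.range f).ncard = n + 1 := ⟨_, (Nat.sub_add_cancel hcard).symm⟩
    refine ⟨n, by rw [← hn]; exact hq.symm, ?_⟩
    have := Fintype.ofFinite (Set.range f)
    let F : D.Arc → Set.range f := fun a => ⟨f a, a, rfl⟩
    refine le_pow_of_solutions (C := D.Crossing) (S := Set.range f) hp (by omega) ?_
      (fun c => F (if c.1.pos then D.inArc c else D.outArc c)) (fun c => F (D.overArc c))
      (fun c => F (if c.1.pos then D.outArc c else D.inArc c)) ?_ (fun s => s.1) ?_
      ⟨F a, F b, hab⟩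
    · rw [← hn, Set.ncard_eq_toFinset_card', Set.toFinset_card]
    -- A rational function on the colors is pulled back along `F` to a coloring of the arcs, which
    -- is constant by `hconst`.
    · rintro g hg ⟨_, a, rfl⟩ ⟨_, b, rfl⟩
      refine KnotDiagram.eq_of_onlyConst (f := fun a => g (F a)) (by positivity) hconst
        (fun c => ?_) a b
      have := hg c
      split_ifs at this ⊢ <;> exact this
    · intro c
      have := hf c
      simp only [F]
      split_ifs at this ⊢ <;> exact this
  obtain ⟨n, hn, hpn⟩ := key
  have hpn' : P.eval (k : ℤ) ≤ (k : ℤ) ^ n := by rw [← hpm]; exact_mod_cast hpn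
  have hk1' : (1 : ℤ) < k := by exact_mod_cast hk1
  rw [hn]
  constructor
  · rintro -
    have := (pow_lt_pow_iff_right₀ hk1').1 ((pow_pred_lt_eval hc hl hd).trans_le hpn')
    omega
  · intro h
    have := (pow_lt_pow_iff_right₀ hk1').1 ((pow_natDegree_lt_eval hc hl h).trans_le hpn')
    omega
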